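/- Let $(M,J,g)$ be a locally conformal Kähler manifold, that is, a Hermitian manifold ($J$ integrable, $g(JX,JY)=g(X,Y)$) whose Kähler form $\Omega(X,Y)=g(X,JY)$ satisfies $d\Omega=\omega\wedge\Omega$ for a globally defined closed $1$-form $\omega$ (the Lee form). Let $B_1=\omega^\sharp$ be the Lee vector field, $g(X,B_1)=\omega(X)$, and let $A=-JB_1$ be the anti-Lee vector field. Let $(B,g_B)$ be a Riemannian manifold and let $\pi:M\to B$ be a Lagrangian Riemannian submersion, i.e. a surjective smooth map of maximal rank whose differential $\pi_*$ preserves the lengths of horizontal vectors and for which $J(\ker\pi_*)=(\ker\pi_*)^\perp$. Assume that $B_1$ is vertical, i.e. $B_1\in\Gamma(\ker\pi_*)$. Denote by $\nabla$ the Levi-Civita connection of $g$, by $\mathcal V,\mathcal H$ the orthogonal projections onto $\ker\pi_*$ and $(\ker\pi_*)^\perp$, and let $$\mathcal T_EF=\mathcal H\nabla_{\mathcal VE}\mathcal VF+\mathcal V\nabla_{\mathcal VE}\mathcal HF,\qquad \mathcal A_EF=\mathcal H\nabla_{\mathcal HE}\mathcal VF+\mathcal V\nabla_{\mathcal HE}\mathcal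 HF$$ be O'Neill's tensors. Let $(\nabla\pi_*)(X,Y)=\nabla^\pi_X\pi_*Y-\pi_*(\nabla_XY)$ be the second fundamental form of $\pi$, where $\nabla^\pi$ is the pullback to $\pi^{-1}(TB)$ of the Levi-Civita connection of $g_B$. Then $\pi$ is a totally geodesic map, i.e. $(\nabla\pi_*)(X,Y)=0$ for all vector fields $X,Y$ on $M$, if and only if both $$\mathcal T_VJW+\tfrac12\,\omega(W)\,JV+\tfrac12\,g(V,W)\,A=0\qquad\text{for all }V,W\in\Gamma(\ker\pi_*)$$ and $$\mathcal A_XJW+\tfrac12\,\omega(W)\,JX+\tfrac12\,\Omega(X,W)\,B_1=0\qquad\text{for all }X\in\Gamma((\ker\pi_*)^\perp),\ W\in\Gamma(\ker\pi_*).$$ -/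

import Mathlib

open Bundle Set
open scoped Manifold ContDiff

set_option linter.unusedSectionVars false

noncomputable section

namespace LCK

section Riemannian

variable {E : Type*} [NormedAddCommGroup E] [NormedSpace ℝ E] [FiniteDimensional ℝ E]
  {H : Type*} [TopologicalSpace H] {I : ModelWithCorners ℝ E H}
  {M : Type*} [TopologicalSpace M] [ChartedSpace H M] [IsManifold I ∞ M]
  [RiemannianBundle (fun x : M ↦ TangentSpace I x)]
  [IsContMDiffRiemannianBundle I ∞ E (fun x : M ↦ TangentSpace I x)]

instance (x : M) : FiniteDimensional ℝ (TangentSpace I x) :=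
  inferInstanceAs (FiniteDimensional ℝ E)

instance (x : M) : CompleteSpace (TangentSpace I x) :=
  FiniteDimensional.complete ℝ _

/-- The function `y ↦ g(X, Y)(y)`. -/
def metricFun (X Y : Π x : M, TangentSpace I x) : M → ℝ := fun y ↦ inner ℝ (X y) (Y y)

/-- Half of the right-hand side of the Koszul formula, which is to be `g(∇_X Y, Z)` at `x`. -/
def koszul (Y X Z : Π x : M, TangentSpace I x) (x : M) : ℝ :=
  (1 / 2 : ℝ) *
    (d% (metricFun Y Z) x (X x) + d% (metricFun Z X) x (Y x) - d% (metricFun X Y) x (Z x)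
      + inner ℝ (VectorField.mlieBracket I X Y x) (Z x)
      - inner ℝ (VectorField.mlieBracket I Y Z x) (X x)
      + inner ℝ (VectorField.mlieBracket I Z X x) (Y x))

section
variable {X X' Y Y' Z : Π x : M, TangentSpace I x} {f : M → ℝ} {x : M}

lemma mdiff_metricFun (hX : MDiffAt (T% X) x) (hY : MDiffAt (T% Y) x) :
    MDiffAt (metricFun X Y) x :=
  MDifferentiableAt.inner_bundle (E := fun x : M ↦ TangentSpace I x) (F := E) hX hY

lemma metricFun_comm (X Y : Π x : M, TangentSpace I x) : metricFun X Y = metricFun Y X := by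
  ext y; exact real_inner_comm _ _

lemma metricFun_add (hX : MDiffAt (T% X) x) (hX' : MDiffAt (T% X') x) (hY : MDiffAt (T% Y) x)
    (v : TangentSpace I x) :
    d% (metricFun (X + X') Y) x v = d% (metricFun X Y) x v + d% (metricFun X' Y) x v := by
  have : metricFun (X + X') Y = metricFun X Y + metricFun X' Y := by
    ext y; simp [metricFun, inner_add_left]
  rw [this, mvfderiv_add (mdiff_metricFun hX hY) (mdiff_metricFun hX' hY)]
  rfl

lemma metricFun_smul (hf : MDiffAt f x) (hX : MDiffAt (T% X) x) (hY : MDiffAt (T% Y) x)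
    (v : TangentSpace I x) :
    d% (metricFun (f • X) Y) x v
      = f x * d% (metricFun X Y) x v + d% f x v * inner ℝ (X x) (Y x) := by
  have : metricFun (f • X) Y = f * metricFun X Y := by
    ext y; simp [metricFun, inner_smul_left]
  rw [this, mvfderiv_mul hf (mdiff_metricFun hX hY)]
  simp [metricFun]
  ring

lemma koszul_tensorial_left (hY : MDiffAt (T% Y) x) (hZ : MDiffAt (T% Z) x) :
    TensorialAt I E (fun X ↦ koszul Y X Z x) x where
  smul {f X} hf hX := by
    dsimp only [koszul]
    rw [metricFun_comm Z (f • X), metricFun_comm Z X, metricFun_smul hf hX hZ,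
      metricFun_smul hf hX hY, VectorField.mlieBracket_smul_left hf hX,
      VectorField.mlieBracket_smul_right hf hX]
    simp only [Pi.smul_apply', map_smul, inner_add_left, inner_smul_left,
      inner_smul_right, smul_eq_mul, RCLike.conj_to_real]
    ring
  add {X X'} hX hX' := by
    dsimp only [koszul]
    rw [metricFun_comm Z (X + X'), metricFun_comm Z X, metricFun_comm Z X',
      metricFun_add hX hX' hZ, metricFun_add hX hX' hY,
      VectorField.mlieBracket_add_left hX hX', VectorField.mlieBracket_add_right hX hX']
    simp only [Pi.add_apply, map_add, inner_add_left, inner_add_right]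
    ring

lemma koszul_tensorial_right (hY : MDiffAt (T% Y) x) (hX : MDiffAt (T% X) x) :
    TensorialAt I E (fun Z ↦ koszul Y X Z x) x where
  smul {f Z} hf hZ := by
    dsimp only [koszul]
    rw [metricFun_comm Y (f • Z), metricFun_comm Y Z, metricFun_smul hf hZ hY,
      metricFun_smul hf hZ hX, VectorField.mlieBracket_smul_left hf hZ,
      VectorField.mlieBracket_smul_right hf hZ]
    simp only [Pi.smul_apply', map_smul, inner_add_left, inner_smul_left,
      inner_smul_right, smul_eq_mul, RCLike.conj_to_real]
    ring
  add {Z Z'} hZ hZ' := by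
    dsimp only [koszul]
    rw [metricFun_comm Y (Z + Z'), metricFun_comm Y Z, metricFun_comm Y Z',
      metricFun_add hZ hZ' hY, metricFun_add hZ hZ' hX,
      VectorField.mlieBracket_add_left hZ hZ', VectorField.mlieBracket_add_right hZ hZ']
    simp only [Pi.add_apply, map_add, inner_add_left, inner_add_right]
    ring

lemma koszul_add (hY : MDiffAt (T% Y) x) (hY' : MDiffAt (T% Y') x) (hX : MDiffAt (T% X) x)
    (hZ : MDiffAt (T% Z) x) :
    koszul (Y + Y') X Z x = koszul Y X Z x + koszul Y' X Z x := by
  dsimp only [koszul]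
  rw [metricFun_comm X (Y + Y'), metricFun_comm X Y, metricFun_comm X Y',
    metricFun_add hY hY' hZ, metricFun_add hY hY' hX,
    VectorField.mlieBracket_add_left hY hY', VectorField.mlieBracket_add_right hY hY']
  simp only [Pi.add_apply, map_add, inner_add_left, inner_add_right]
  ring

lemma koszul_smul (hf : MDiffAt f x) (hY : MDiffAt (T% Y) x) (hX : MDiffAt (T% X) x)
    (hZ : MDiffAt (T% Z) x) :
    koszul (f • Y) X Z x
      = f x * koszul Y X Z x + d% f x (X x) * inner ℝ (Y x) (Z x) := by
  dsimp only [koszul]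
  rw [metricFun_comm X (f • Y), metricFun_comm X Y, metricFun_smul hf hY hZ,
    metricFun_smul hf hY hX, VectorField.mlieBracket_smul_left hf hY,
    VectorField.mlieBracket_smul_right hf hY]
  simp only [Pi.smul_apply', map_smul, inner_add_left, inner_smul_left,
    inner_smul_right, smul_eq_mul, RCLike.conj_to_real]
  ring

/-- The Koszul expression as a bilinear form in the values of `X` and `Z` at `x`. -/
def koszulForm (Y : Π x : M, TangentSpace I x) (x : M) (hY : MDiffAt (T% Y) x) :
    TangentSpace I x →L[ℝ] TangentSpace I x →L[ℝ] ℝ :=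
  TensorialAt.mkHom₂ (fun X Z ↦ koszul Y X Z x) x
    (fun _ hZ ↦ koszul_tensorial_left hY hZ) (fun _ hX ↦ koszul_tensorial_right hY hX)

lemma koszulForm_apply (hY : MDiffAt (T% Y) x) (hX : MDiffAt (T% X) x) (hZ : MDiffAt (T% Z) x) :
    koszulForm Y x hY (X x) (Z x) = koszul Y X Z x :=
  TensorialAt.mkHom₂_apply _ _ hX hZ

open Classical in
/-- `v ↦ ∇_v Y` at `x`: the vector `∇_v Y` is the one that represents the Koszul form with respect
to the metric, written in an orthonormal basis of the tangent space. At points where `Y` is not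
differentiable the value is set to `0`. -/
def leviCivitaFun (Y : Π x : M, TangentSpace I x) (x : M) :
    TangentSpace I x →L[ℝ] TangentSpace I x :=
  if hY : MDiffAt (T% Y) x then
    ∑ i, ((koszulForm Y x hY).flip (stdOrthonormalBasis ℝ (TangentSpace I x) i)).smulRight
      (stdOrthonormalBasis ℝ (TangentSpace I x) i)
  else 0

/-- The Koszul formula. -/
lemma inner_leviCivitaFun (hY : MDiffAt (T% Y) x) (hX : MDiffAt (T% X) x)
    (hZ : MDiffAt (T% Z) x) :
    inner ℝ (leviCivitaFun Y x (X x)) (Z x) = koszul Y X Z x := by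
  rw [← koszulForm_apply hY hX hZ, leviCivitaFun, dif_pos hY]
  conv_rhs => rw [← (stdOrthonormalBasis ℝ (TangentSpace I x)).sum_repr' (Z x)]
  simp only [sum_apply, ContinuousLinearMap.smulRight_apply, sum_inner,
    inner_smul_left, map_sum, map_smul, smul_eq_mul, ContinuousLinearMap.flip_apply,
    RCLike.conj_to_real]
  exact Finset.sum_congr rfl fun i _ ↦ mul_comm _ _

lemma eq_of_inner_sections {u v : TangentSpace I x}
    (h : ∀ Z : Π x : M, TangentSpace I x, MDiffAt (T% Z) x → inner ℝ u (Z x) = inner ℝ v (Z x)) :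
    u = v := by
  refine ext_inner_right ℝ fun w ↦ ?_
  simpa using h (FiberBundle.extend E w) (FiberBundle.mdifferentiableAt_extend ..)

variable (I M) in
/-- The Levi-Civita connection of the metric, as a covariant derivative on the tangent bundle.
`leviCivita I M Y x v` is `∇_v Y` for a tangent vector `v` at `x`. -/
def leviCivita : CovariantDerivative I E (TangentSpace I : M → Type _) where
  toFun := leviCivitaFun
  isCovariantDerivativeOnUniv := {
    add := by
      intro Y Y' x hY hY' _
      ext v
      refine eq_of_inner_sections fun Z hZ ↦ ?_
      have hX := FiberBundle.mdifferentiableAt_extend (I := I) E v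
      have hv : v = FiberBundle.extend E v x := by simp
      rw [hv, add_apply, inner_add_left,
        inner_leviCivitaFun (mdifferentiableAt_add_section hY hY') hX hZ,
        inner_leviCivitaFun hY hX hZ, inner_leviCivitaFun hY' hX hZ, koszul_add hY hY' hX hZ]
    leibniz := by
      intro Y f x hY hf _
      ext v
      refine eq_of_inner_sections fun Z hZ ↦ ?_
      have hX := FiberBundle.mdifferentiableAt_extend (I := I) E v
      have hv : v = FiberBundle.extend E v x := by simp
      rw [hv, inner_leviCivitaFun (hf.smul_section hY) hX hZ, koszul_smul hf hY hX hZ,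
        ← inner_leviCivitaFun hY hX hZ]
      simp [inner_add_left, inner_smul_left] }

/-- The Levi-Civita connection is torsion free. -/
theorem torsion_leviCivita : (leviCivita I M).torsion = 0 := by
  rw [CovariantDerivative.torsion_eq_zero_iff]
  intro X Y x hX hY
  refine eq_of_inner_sections fun Z hZ ↦ ?_
  change inner ℝ (leviCivitaFun Y x (X x) - leviCivitaFun X x (Y x)) (Z x) = _
  rw [inner_sub_left, inner_leviCivitaFun hY hX hZ, inner_leviCivitaFun hX hY hZ]
  dsimp only [koszul]
  rw [metricFun_comm X Z, metricFun_comm Z Y, metricFun_comm X Y,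
    VectorField.mlieBracket_swap_apply (V := Y) (W := X),
    VectorField.mlieBracket_swap_apply (V := Z) (W := X),
    VectorField.mlieBracket_swap_apply (V := Z) (W := Y)]
  simp only [inner_neg_left]
  ring

/-- The Levi-Civita connection is compatible with the metric. -/
theorem mvfderiv_metricFun (hX : MDiffAt (T% X) x) (hY : MDiffAt (T% Y) x)
    (hZ : MDiffAt (T% Z) x) :
    d% (metricFun Y Z) x (X x) = inner ℝ (leviCivita I M Y x (X x)) (Z x)
      + inner ℝ (Y x) (leviCivita I M Z x (X x)) := by
  change d% (metricFun Y Z) x (X x) = inner ℝ (leviCivitaFun Y x (X x)) (Z x)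
    + inner ℝ (Y x) (leviCivitaFun Z x (X x))
  rw [real_inner_comm (leviCivitaFun Z x (X x)), inner_leviCivitaFun hY hX hZ,
    inner_leviCivitaFun hZ hX hY]
  dsimp only [koszul]
  rw [metricFun_comm Z Y, metricFun_comm Y X, metricFun_comm Z X,
    VectorField.mlieBracket_swap_apply (V := Y) (W := X),
    VectorField.mlieBracket_swap_apply (V := Z) (W := X),
    VectorField.mlieBracket_swap_apply (V := Z) (W := Y)]
  simp only [inner_neg_left]
  ring

end

end Riemannian

section Hermitian

variable {E : Type*} [NormedAddCommGroup E] [NormedSpace ℝ E] [FiniteDimensional ℝ E]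
  {H : Type*} [TopologicalSpace H] {I : ModelWithCorners ℝ E H}
  {M : Type*} [TopologicalSpace M] [ChartedSpace H M] [IsManifold I ∞ M]
  [RiemannianBundle (fun x : M ↦ TangentSpace I x)]
  [IsContMDiffRiemannianBundle I ∞ E (fun x : M ↦ TangentSpace I x)]

/-- `X` is a smooth vector field on `M`. -/
def IsSmoothField (X : Π x : M, TangentSpace I x) : Prop :=
  ContMDiff I I.tangent ∞ (fun x ↦ (⟨x, X x⟩ : TangentBundle I M))

/-- The field of endomorphisms `J` applied to a vector field. -/
def appField (J : Π x : M, TangentSpace I x →L[ℝ] TangentSpace I x)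
    (X : Π x : M, TangentSpace I x) : Π x : M, TangentSpace I x := fun x ↦ J x (X x)

/-- `(M, J, g)` is a Hermitian manifold: `J` is a smooth almost complex structure that is orthogonal
for `g` and integrable (its Nijenhuis tensor vanishes). -/
structure IsHermitian (J : Π x : M, TangentSpace I x →L[ℝ] TangentSpace I x) : Prop where
  smooth : ContMDiff I (I.prod 𝓘(ℝ, E →L[ℝ] E)) ∞
    (fun x ↦ TotalSpace.mk' (E →L[ℝ] E)
      (E := fun x : M ↦ TangentSpace I x →L[ℝ] TangentSpace I x) x (J x))
  sq (x : M) (v : TangentSpace I x) : J x (J x v) = -v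
  orthogonal (x : M) (v w : TangentSpace I x) : inner ℝ (J x v) (J x w) = inner ℝ v w
  nijenhuis (X Y : Π x : M, TangentSpace I x) (hX : IsSmoothField X) (hY : IsSmoothField Y)
    (x : M) :
    VectorField.mlieBracket I (appField J X) (appField J Y) x
      - J x (VectorField.mlieBracket I (appField J X) Y x)
      - J x (VectorField.mlieBracket I X (appField J Y) x)
      - VectorField.mlieBracket I X Y x = 0

/-- The Kähler form `Ω(v, w) = g(v, J w)`. -/
def kaehlerForm (J : Π x : M, TangentSpace I x →L[ℝ] TangentSpace I x) (x : M)
    (v w : TangentSpace I x) : ℝ := inner ℝ v (J x w)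

/-- The exterior derivative of a 1-form, evaluated on vector fields. -/
def extDeriv₁ (ω₀ : Π x : M, TangentSpace I x →L[ℝ] ℝ) (X Y : Π x : M, TangentSpace I x)
    (x : M) : ℝ :=
  mvfderiv I (fun y ↦ ω₀ y (Y y)) x (X x) - mvfderiv I (fun y ↦ ω₀ y (X y)) x (Y x)
    - ω₀ x (VectorField.mlieBracket I X Y x)

/-- The exterior derivative of a 2-form, evaluated on vector fields. -/
def extDeriv₂ (η : Π x : M, TangentSpace I x → TangentSpace I x → ℝ)
    (X Y Z : Π x : M, TangentSpace I x) (x : M) : ℝ :=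
  mvfderiv I (fun y ↦ η y (Y y) (Z y)) x (X x) + mvfderiv I (fun y ↦ η y (Z y) (X y)) x (Y x)
    + mvfderiv I (fun y ↦ η y (X y) (Y y)) x (Z x)
    - η x (VectorField.mlieBracket I X Y x) (Z x) - η x (VectorField.mlieBracket I Y Z x) (X x)
    - η x (VectorField.mlieBracket I Z X x) (Y x)

/-- The wedge product of a 1-form and a 2-form. -/
def wedge₁₂ (ω₀ : Π x : M, TangentSpace I x →L[ℝ] ℝ)
    (η : Π x : M, TangentSpace I x → TangentSpace I x → ℝ) (x : M)
    (u v w : TangentSpace I x) : ℝ :=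
  ω₀ x u * η x v w + ω₀ x v * η x w u + ω₀ x w * η x u v

/-- `ω₀` is a Lee form of `(M, J, g)`: a smooth closed 1-form with `dΩ = ω₀ ∧ Ω`. -/
structure IsLeeForm (J : Π x : M, TangentSpace I x →L[ℝ] TangentSpace I x)
    (ω₀ : Π x : M, TangentSpace I x →L[ℝ] ℝ) : Prop where
  smooth : ContMDiff I (I.prod 𝓘(ℝ, E →L[ℝ] ℝ)) ∞
    (fun x ↦ TotalSpace.mk' (E →L[ℝ] ℝ) (E := fun x : M ↦ TangentSpace I x →L[ℝ] ℝ) x (ω₀ x))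
  closed (X Y : Π x : M, TangentSpace I x) (hX : IsSmoothField X) (hY : IsSmoothField Y) (x : M) :
    extDeriv₁ ω₀ X Y x = 0
  extDeriv_kaehlerForm (X Y Z : Π x : M, TangentSpace I x) (hX : IsSmoothField X)
    (hY : IsSmoothField Y) (hZ : IsSmoothField Z) (x : M) :
    extDeriv₂ (kaehlerForm J) X Y Z x = wedge₁₂ ω₀ (kaehlerForm J) x (X x) (Y x) (Z x)

/-- `(M, J, g)` is locally conformal Kähler, with Lee form `ω₀`. -/
structure IsLCK (J : Π x : M, TangentSpace I x →L[ℝ] TangentSpace I x)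
    (ω₀ : Π x : M, TangentSpace I x →L[ℝ] ℝ) : Prop where
  hermitian : IsHermitian J
  lee : IsLeeForm J ω₀

/-- The Lee vector field `B₁ = ω₀♯`, that is, `g(X, B₁) = ω₀(X)`. -/
def leeField (ω₀ : Π x : M, TangentSpace I x →L[ℝ] ℝ) : Π x : M, TangentSpace I x :=
  fun x ↦ (InnerProductSpace.toDual ℝ (TangentSpace I x)).symm (ω₀ x)

lemma inner_leeField (ω₀ : Π x : M, TangentSpace I x →L[ℝ] ℝ) (x : M) (v : TangentSpace I x) :
    inner ℝ v (leeField ω₀ x) = ω₀ x v := by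
  rw [real_inner_comm]
  exact InnerProductSpace.toDual_symm_apply

/-- The anti-Lee vector field `A = -J B₁`. -/
def antiLeeField (J : Π x : M, TangentSpace I x →L[ℝ] TangentSpace I x)
    (ω₀ : Π x : M, TangentSpace I x →L[ℝ] ℝ) : Π x : M, TangentSpace I x :=
  fun x ↦ -J x (leeField ω₀ x)

end Hermitian

section Submersion

variable {E : Type*} [NormedAddCommGroup E] [NormedSpace ℝ E] [FiniteDimensional ℝ E]
  {H : Type*} [TopologicalSpace H] (I : ModelWithCorners ℝ E H)
  {M : Type*} [TopologicalSpace M] [ChartedSpace H M] [IsManifold I ∞ M]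
  [RiemannianBundle (fun x : M ↦ TangentSpace I x)]
  [IsContMDiffRiemannianBundle I ∞ E (fun x : M ↦ TangentSpace I x)]
  {E' : Type*} [NormedAddCommGroup E'] [NormedSpace ℝ E'] [FiniteDimensional ℝ E']
  {H' : Type*} [TopologicalSpace H'] (I' : ModelWithCorners ℝ E' H')
  {B : Type*} [TopologicalSpace B] [ChartedSpace H' B] [IsManifold I' ∞ B]
  [RiemannianBundle (fun x : B ↦ TangentSpace I' x)]
  [IsContMDiffRiemannianBundle I' ∞ E' (fun x : B ↦ TangentSpace I' x)]

/-- The vertical space `ker π_*` at `x`. -/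
def vertical (pr : M → B) (x : M) : Submodule ℝ (TangentSpace I x) :=
  LinearMap.ker (mfderiv I I' pr x : TangentSpace I x →ₗ[ℝ] TangentSpace I' (pr x))

/-- The horizontal space `(ker π_*)ᗮ` at `x`. -/
def horizontal (pr : M → B) (x : M) : Submodule ℝ (TangentSpace I x) := (vertical I I' pr x)ᗮ

/-- A Riemannian submersion of `M` onto `B`. -/
structure IsRiemannianSubmersion (pr : M → B) : Prop where
  smooth : ContMDiff I I' ∞ pr
  surjective : Function.Surjective pr
  maximal_rank (x : M) : Function.Surjective (mfderiv I I' pr x)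
  norm_map (x : M) (v : TangentSpace I x) (hv : v ∈ horizontal I I' pr x) :
    ‖mfderiv I I' pr x v‖ = ‖v‖

/-- A Lagrangian Riemannian submersion: `J (ker π_*) = (ker π_*)ᗮ`. -/
structure IsLagrangianSubmersion (J : Π x : M, TangentSpace I x →L[ℝ] TangentSpace I x)
    (pr : M → B) : Prop where
  riemannian : IsRiemannianSubmersion I I' pr
  lagrangian (x : M) :
    (vertical I I' pr x).map (J x : TangentSpace I x →ₗ[ℝ] TangentSpace I x) = horizontal I I' pr x

/-- The vertical part `𝒱X` of a vector field. -/
def vert (pr : M → B) (X : Π x : M, TangentSpace I x) : Π x : M, TangentSpace I x :=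
  fun x ↦ (vertical I I' pr x).starProjection (X x)

/-- The horizontal part `ℋX` of a vector field. -/
def hor (pr : M → B) (X : Π x : M, TangentSpace I x) : Π x : M, TangentSpace I x :=
  fun x ↦ (horizontal I I' pr x).starProjection (X x)

/-- `∇_X Y` for the Levi-Civita connection of `M`. -/
def nabla (X Y : Π x : M, TangentSpace I x) : Π x : M, TangentSpace I x :=
  fun x ↦ leviCivita I M Y x (X x)

/-- O'Neill's tensor `𝒯_X Y = ℋ∇_{𝒱X} 𝒱Y + 𝒱∇_{𝒱X} ℋY`. -/
def tensorT (pr : M → B) (X Y : Π x : M, TangentSpace I x) : Π x : M, TangentSpace I x :=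
  hor I I' pr (nabla I (vert I I' pr X) (vert I I' pr Y))
    + vert I I' pr (nabla I (vert I I' pr X) (hor I I' pr Y))

/-- O'Neill's tensor `𝒜_X Y = ℋ∇_{ℋX} 𝒱Y + 𝒱∇_{ℋX} ℋY`. -/
def tensorA (pr : M → B) (X Y : Π x : M, TangentSpace I x) : Π x : M, TangentSpace I x :=
  hor I I' pr (nabla I (hor I I' pr X) (vert I I' pr Y))
    + vert I I' pr (nabla I (hor I I' pr X) (hor I I' pr Y))

/-- The pullback connection: for a section `s` of `φ⁻¹(TB)` and a tangent vector `v` at `x`, this is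
`∇^φ_v s = ∑ i, (d(sⁱ)(v) • eᵢ + sⁱ • ∇_{φ_* v} eᵢ)`, where `s = ∑ i, sⁱ • (eᵢ ∘ φ)` in the
local frame `(eᵢ)` of `TB` near `φ x` that comes from the preferred trivialization there. -/
def pullbackCov (φ : M → B) (s : Π x : M, TangentSpace I' (φ x)) (x : M)
    (v : TangentSpace I x) : TangentSpace I' (φ x) :=
  let e := trivializationAt E' (TangentSpace I' : B → Type _) (φ x)
  let b := Module.finBasis ℝ E'
  ∑ i, (mvfderiv I (fun y ↦ e.localFrameCoeff I' b i (φ y) (s y)) x v • e.localFrame b i (φ x)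
    + e.localFrameCoeff I' b i (φ x) (s x) •
      leviCivita I' B (e.localFrame b i) (φ x) (mfderiv I I' φ x v))

/-- The second fundamental form `(∇φ_*)(X, Y) = ∇^φ_X (φ_* Y) - φ_*(∇_X Y)`. -/
def secondFundamentalForm (φ : M → B) (X Y : Π x : M, TangentSpace I x) (x : M) :
    TangentSpace I' (φ x) :=
  pullbackCov I I' φ (fun y ↦ mfderiv I I' φ y (Y y)) x (X x) - mfderiv I I' φ x (nabla I X Y x)

/-- `φ` is a totally geodesic map: `∇φ_* = 0`. -/
def IsTotallyGeodesicMap (φ : M → B) : Prop :=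
  ∀ X Y : Π x : M, TangentSpace I x, IsSmoothField X → IsSmoothField Y →
    ∀ x, secondFundamentalForm I I' φ X Y x = 0

/-- `V ∈ Γ(ker π_*)`. -/
def IsVerticalField (pr : M → B) (V : Π x : M, TangentSpace I x) : Prop :=
  IsSmoothField V ∧ ∀ x, V x ∈ vertical I I' pr x

/-- `X ∈ Γ((ker π_*)ᗮ)`. -/
def IsHorizontalField (pr : M → B) (X : Π x : M, TangentSpace I x) : Prop :=
  IsSmoothField X ∧ ∀ x, X x ∈ horizontal I I' pr x

end Submersion

end LCK

end

open Bundle Set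
open scoped Manifold ContDiff

set_option linter.unusedSectionVars false

noncomputable section

namespace LCK

section Calculus

variable {E : Type*} [NormedAddCommGroup E] [NormedSpace ℝ E] [FiniteDimensional ℝ E]
  {H : Type*} [TopologicalSpace H] {I : ModelWithCorners ℝ E H} [I.Boundaryless]
  {M : Type*} [TopologicalSpace M] [ChartedSpace H M] [IsManifold I ∞ M]

open Filter Topology VectorField

lemma mvfderiv_congr {f g : M → ℝ} {x : M} (h : f =ᶠ[𝓝 x] g) : d% f x = d% g x :=
  h.mfderiv_eq

/-- The derivative of a function along a vector field, read in a chart. -/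
lemma mvfderiv_apply_eventuallyEq_chart {f : M → ℝ} {x : M} (hf : CMDiffAt 2 f x)
    (Y : Π x : M, TangentSpace I x) :
    (fun y ↦ d% f y (Y y)) =ᶠ[𝓝 x] (fun z ↦ fderiv ℝ (f ∘ (extChartAt I x).symm) z
      (mpullbackWithin 𝓘(ℝ, E) I (extChartAt I x).symm Y (range I) z)) ∘ extChartAt I x := by
  have h1 : ∀ᶠ y in 𝓝 x, MDiffAt f y :=
    ((contMDiffAt_iff_contMDiffAt_nhds (by simp)).1 hf).mono
      fun y hy ↦ hy.mdifferentiableAt (by simp)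
  filter_upwards [h1, extChartAt_source_mem_nhds (I := I) x] with y hy hys
  have hz : extChartAt I x y ∈ (extChartAt I x).target := (extChartAt I x).map_source hys
  have hyz : (extChartAt I x).symm (extChartAt I x y) = y := (extChartAt I x).left_inv hys
  have hsymm : MDiffAt (extChartAt I x).symm (extChartAt I x y) := by
    rw [← mdifferentiableWithinAt_univ, ← I.range_eq_univ]
    exact mdifferentiableWithinAt_extChartAt_symm (I := I) hz
  have hinv := isInvertible_mfderivWithin_extChartAt_symm (I := I) hz
  have hc := mvfderiv_comp_apply_of_eq (extChartAt I x y) hy hsymm hyz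
    (mpullbackWithin 𝓘(ℝ, E) I (extChartAt I x).symm Y (range I) (extChartAt I x y))
  have e1 : mfderiv% (extChartAt I x).symm (extChartAt I x y)
      (mpullbackWithin 𝓘(ℝ, E) I (extChartAt I x).symm Y (range I) (extChartAt I x y))
      = Y ((extChartAt I x).symm (extChartAt I x y)) := by
    rw [mpullbackWithin_apply, ← mfderivWithin_univ, ← I.range_eq_univ]
    exact hinv.self_apply_inverse _
  have e2 : ∀ v, mvfderiv 𝓘(ℝ, E) (f ∘ (extChartAt I x).symm) (extChartAt I x y) v
      = fderiv ℝ (f ∘ (extChartAt I x).symm) (extChartAt I x y) v := by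
    intro v
    rw [← mfderiv_eq_fderiv]
    rfl
  rw [e1, e2] at hc
  rw [Function.comp_apply, hc]
  have : ∀ y' (h : y' = y), d% f y (Y y) = d% f y' (Y y') := by rintro _ rfl; rfl
  rw [this _ hyz]
  have : ∀ y' (h : y' = y) (v : TangentSpace I y'), d% f y' v = d% f y v := by rintro _ rfl v; rfl
  exact this _ hyz _

lemma differentiableAt_mpullbackWithin_chart {Y : Π x : M, TangentSpace I x} {x : M}
    (hY : MDiffAt (T% Y) x) :
    DifferentiableAt ℝ (mpullbackWithin 𝓘(ℝ, E) I (extChartAt I x).symm Y (range I))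
      (extChartAt I x x) := by
  have := MDifferentiableWithinAt.differentiableWithinAt_mpullbackWithin_vectorField
    (mdifferentiableWithinAt_univ.2 hY)
  rw [preimage_univ, univ_inter, I.range_eq_univ] at this
  rw [I.range_eq_univ]
  exact this.differentiableAt univ_mem

lemma contDiffAt_comp_extChartAt_symm {f : M → ℝ} {x : M} {n : ℕ∞ω} (hf : CMDiffAt n f x) :
    ContDiffAt ℝ n (f ∘ (extChartAt I x).symm) (extChartAt I x x) := by
  have := (contMDiffAt_iff.1 hf).2
  rw [I.range_eq_univ] at this
  exact this.contDiffAt univ_mem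

/-- Differentiability of the derivative of a function along a vector field. -/
lemma mdifferentiableAt_mvfderiv_apply {f : M → ℝ} {x : M} (hf : CMDiffAt 2 f x)
    {Y : Π x : M, TangentSpace I x} (hY : MDiffAt (T% Y) x) :
    MDiffAt (fun y ↦ d% f y (Y y)) x := by
  refine MDifferentiableAt.congr_of_eventuallyEq ?_ (mvfderiv_apply_eventuallyEq_chart hf Y)
  have h1 := (contDiffAt_comp_extChartAt_symm hf).fderiv_right (m := 1) (by norm_num)
  exact (h1.differentiableAt (by simp)).clm_apply (differentiableAt_mpullbackWithin_chart hY)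
    |>.mdifferentiableAt.comp x (mdifferentiableAt_extChartAt (mem_chart_source H x))

/-- `X (Y f) - Y (X f) = [X, Y] f`. -/
lemma mvfderiv_mlieBracket {f : M → ℝ} {x : M} (hf : CMDiffAt 2 f x)
    {X Y : Π x : M, TangentSpace I x} (hX : MDiffAt (T% X) x) (hY : MDiffAt (T% Y) x) :
    d% f x (mlieBracket I X Y x)
      = d% (fun y ↦ d% f y (Y y)) x (X x) - d% (fun y ↦ d% f y (X y)) x (Y x) := by
  set F := f ∘ (extChartAt I x).symm with hF
  set p : (Π x : M, TangentSpace I x) → E → E :=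
    fun Y ↦ mpullbackWithin 𝓘(ℝ, E) I (extChartAt I x).symm Y (range I) with hp
  set z := extChartAt I x x with hz
  have hFd := contDiffAt_comp_extChartAt_symm hf
  have h1 : DifferentiableAt ℝ (fderiv ℝ F) z :=
    (hFd.fderiv_right (m := 1) (by norm_num)).differentiableAt (by simp)
  have hsy : IsSymmSndFDerivAt ℝ F z := hFd.isSymmSndFDerivAt (by simp)
  have hφ : MDiffAt (extChartAt I x) x := mdifferentiableAt_extChartAt (mem_chart_source H x)
  have hpv : ∀ X : Π x : M, TangentSpace I x, mfderiv% (extChartAt I x) x (X x) = p X z := by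
    intro X
    rw [mfderiv_extChartAt_self]
    have h (y : M) (hy : y = x) : (X y : E) = X x := by rw [hy]
    have := mfderivWithin_extChartAt_symm_inverse_apply (I := I) (x := x) (X x)
    rw [← h _ (extChartAt_to_inv (I := I) x)] at this
    exact ((h _ (extChartAt_to_inv (I := I) x)).symm).trans this.symm
  have key : ∀ X Y : Π x : M, TangentSpace I x, MDiffAt (T% Y) x →
      d% (fun y ↦ d% f y (Y y)) x (X x)
        = fderiv ℝ (fderiv ℝ F) z (p X z) (p Y z) + fderiv ℝ F z (fderiv ℝ (p Y) z (p X z)) := by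
    intro X Y hY
    have hpY : DifferentiableAt ℝ (p Y) z := differentiableAt_mpullbackWithin_chart hY
    have hg : DifferentiableAt ℝ (fun z ↦ fderiv ℝ F z (p Y z)) z := h1.clm_apply hpY
    have hc := mvfderiv_comp_apply (I := 𝓘(ℝ, E)) x hg.mdifferentiableAt hφ (X x)
    have e1 : d% (fun y ↦ d% f y (Y y)) x
        = d% ((fun z ↦ fderiv ℝ F z (p Y z)) ∘ extChartAt I x) x :=
      mvfderiv_congr (mvfderiv_apply_eventuallyEq_chart hf Y)
    rw [e1, hc, hpv]
    change mfderiv 𝓘(ℝ, E) 𝓘(ℝ, ℝ) (fun z ↦ fderiv ℝ F z (p Y z)) z (p X z) = _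
    rw [mfderiv_eq_fderiv, fderiv_clm_apply h1 hpY]
    exact add_comm _ _
  have e2 : d% f x (mlieBracket I X Y x)
      = fderiv ℝ F z (mfderiv% (extChartAt I x) x (mlieBracket I X Y x)) := by
    have hFx : f =ᶠ[𝓝 x] F ∘ extChartAt I x := by
      filter_upwards [extChartAt_source_mem_nhds (I := I) x] with y hy
      rw [hF, Function.comp_apply, Function.comp_apply, (extChartAt I x).left_inv hy]
    have hc := mvfderiv_comp_apply (I := 𝓘(ℝ, E)) x
      (hFd.differentiableAt (by simp)).mdifferentiableAt hφ (mlieBracket I X Y x)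
    have e1 : d% f x = d% (F ∘ extChartAt I x) x := mvfderiv_congr hFx
    rw [e1, hc]
    change mfderiv 𝓘(ℝ, E) 𝓘(ℝ, ℝ) F z _ = _
    rw [mfderiv_eq_fderiv]
    rfl
  have e3 : mfderiv% (extChartAt I x) x (mlieBracket I X Y x) = lieBracket ℝ (p X) (p Y) z := by
    rw [← mlieBracketWithin_univ, mlieBracketWithin_apply]
    refine ((isInvertible_mfderiv_extChartAt (mem_extChartAt_source x)).self_apply_inverse
      _).trans ?_
    rw [preimage_univ, univ_inter, ← lieBracketWithin_univ, ← I.range_eq_univ]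
  rw [key X Y hY, key Y X hX, hsy.eq, e2, e3, lieBracket_eq, map_sub]
  ring

/-- The coordinates of a point in the preferred chart at `x₀`. -/
def chartCoord (I : ModelWithCorners ℝ E H) {ι : Type*} (b : Module.Basis ι ℝ E) (x₀ : M) (i : ι) :
    M → ℝ :=
  fun y ↦ (b.coord i).toContinuousLinearMap (extChartAt I x₀ y)

lemma contMDiffAt_chartCoord {ι : Type*} (b : Module.Basis ι ℝ E) (x₀ : M) (i : ι) {n : ℕ∞}
    {y : M} (hy : y ∈ (chartAt H x₀).source) : CMDiffAt n (chartCoord I b x₀ i) y := by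
  have : IsManifold I n M := .of_le (n := ∞) (by exact_mod_cast le_top)
  exact (b.coord i).toContinuousLinearMap.contMDiff.contMDiffAt.comp y
    (contMDiffAt_extChartAt' hy)

lemma mvfderiv_chartCoord {ι : Type*} (b : Module.Basis ι ℝ E) (x₀ : M) (i : ι)
    {y : M} (hy : y ∈ (chartAt H x₀).source) (v : TangentSpace I y) :
    d% (chartCoord I b x₀ i) y v
      = (trivializationAt E (TangentSpace I : M → Type _) x₀).localFrameCoeff I b i y v := by
  set e := trivializationAt E (TangentSpace I : M → Type _) x₀ with he
  have hye : y ∈ e.baseSet := hy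
  have h1 := e.localFrameCoeff_eq_coeff (I := I) (b := b) (s := FiberBundle.extend E v) hye (i := i)
  rw [FiberBundle.extend_apply_self] at h1
  rw [h1]
  have h2 : (e (T% (FiberBundle.extend E v) y)).2 = mfderiv% (extChartAt I x₀) y v := by
    rw [← TangentBundle.continuousLinearMapAt_trivializationAt hy]
    simp only [FiberBundle.extend_apply_self]
    exact (congrFun (e.coe_linearMapAt_of_mem (R := ℝ) hye) v).symm
  rw [h2]
  have hd : MDiffAt (extChartAt I x₀) y := mdifferentiableAt_extChartAt hy
  have hc := mvfderiv_comp_apply (I := 𝓘(ℝ, E)) y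
    (g := (b.coord i).toContinuousLinearMap)
    (b.coord i).toContinuousLinearMap.mdifferentiableAt hd v
  refine hc.trans ?_
  change mfderiv 𝓘(ℝ, E) 𝓘(ℝ, ℝ) (b.coord i).toContinuousLinearMap _ _ = _
  rw [mfderiv_eq_fderiv, ContinuousLinearMap.fderiv]
  rfl

lemma eq_of_localFrameCoeff_eq {ι : Type*} [Fintype ι] (b : Module.Basis ι ℝ E) {x₀ y : M}
    (hy : y ∈ (chartAt H x₀).source) {v w : TangentSpace I y}
    (h : ∀ i, (trivializationAt E (TangentSpace I : M → Type _) x₀).localFrameCoeff I b i y v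
      = (trivializationAt E (TangentSpace I : M → Type _) x₀).localFrameCoeff I b i y w) :
    v = w := by
  set e := trivializationAt E (TangentSpace I : M → Type _) x₀ with he
  have hye : y ∈ e.baseSet := hy
  have hv := e.eq_sum_localFrameCoeff_smul (I := I) (b := b) (s := FiberBundle.extend E v) hye
  have hw := e.eq_sum_localFrameCoeff_smul (I := I) (b := b) (s := FiberBundle.extend E w) hye
  simp only [FiberBundle.extend_apply_self] at hv hw
  rw [hv, hw]
  exact Finset.sum_congr rfl fun i _ ↦ by rw [h i]

/-- The brackets of the coordinate vector fields vanish. -/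
lemma mlieBracket_localFrame {ι : Type*} [Fintype ι] (b : Module.Basis ι ℝ E) (x : M) (i j : ι) :
    mlieBracket I ((trivializationAt E (TangentSpace I : M → Type _) x).localFrame b i)
      ((trivializationAt E (TangentSpace I : M → Type _) x).localFrame b j) x = 0 := by
  classical
  set e := trivializationAt E (TangentSpace I : M → Type _) x with he
  have hx : x ∈ e.baseSet := mem_chart_source H x
  have hd (i) : MDiffAt (T% (e.localFrame b i)) x :=
    (contMDiffAt_localFrame_of_mem (I := I) 1 e b i hx).mdifferentiableAt (by simp)
  refine eq_of_localFrameCoeff_eq b (mem_chart_source H x) fun k ↦ ?_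
  have hcst (j) : d% (fun y ↦ d% (chartCoord I b x k) y (e.localFrame b j y)) x = 0 := by
    have : (fun y ↦ d% (chartCoord I b x k) y (e.localFrame b j y)) =ᶠ[𝓝 x]
        fun _ ↦ if j = k then 1 else 0 := by
      filter_upwards [e.open_baseSet.mem_nhds hx] with y hy
      rw [mvfderiv_chartCoord b x k hy, e.localFrameCoeff_apply_of_mem_baseSet b hy,
        e.localFrame_apply_of_mem_baseSet b hy, Module.Basis.repr_self, Finsupp.single_apply]
    exact (mvfderiv_congr this).trans (mvfderiv_const _)
  rw [← mvfderiv_chartCoord b x k (mem_chart_source H x), mvfderiv_mlieBracket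
    (contMDiffAt_chartCoord (n := 2) b x k (mem_chart_source H x)) (hd i) (hd j), hcst, hcst, map_zero]
  simp

end Calculus

section SmoothFields

variable {E : Type*} [NormedAddCommGroup E] [NormedSpace ℝ E] [FiniteDimensional ℝ E]
  {H : Type*} [TopologicalSpace H] {I : ModelWithCorners ℝ E H}
  {M : Type*} [TopologicalSpace M] [ChartedSpace H M] [IsManifold I ∞ M]

open Filter Topology

lemma contMDiffAt_det {ι : Type*} [Fintype ι] [DecidableEq ι] {A : M → Matrix ι ι ℝ} {x : M}
    {n : ℕ∞ω} (h : ∀ i j, CMDiffAt n (fun y ↦ A y i j) x) : CMDiffAt n (fun y ↦ (A y).det) x := by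
  simp only [Matrix.det_apply']
  refine ContMDiffAt.sum fun σ _ ↦ ?_
  exact contMDiffAt_const.mul (contMDiffAt_finsetProd fun i _ ↦ h _ _)

/-- Every tangent vector extends to a smooth vector field. -/
lemma exists_isSmoothField [T2Space M] [I.Boundaryless] (x : M) (v : TangentSpace I x) :
    ∃ X : Π x : M, TangentSpace I x, IsSmoothField X ∧ X x = v := by
  let f : SmoothBumpFunction I x := Classical.arbitrary _
  refine ⟨fun y ↦ f y • FiberBundle.extend E v y, fun y ↦ ?_, by simp⟩
  by_cases hy : y ∈ tsupport f
  · have hys := f.tsupport_subset_chartAt_source hy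
    have hE : CMDiffAt ∞ (T% (FiberBundle.extend E v)) y := by
      have hyb : y ∈ (trivializationAt E (TangentSpace I : M → Type _) x).baseSet := hys
      rw [Trivialization.contMDiffAt_section_iff _ hyb]
      refine (contMDiffAt_const
        (c := (trivializationAt E (TangentSpace I : M → Type _) x ⟨x, v⟩).2)).congr_of_eventuallyEq ?_
      filter_upwards [(Trivialization.open_baseSet _).mem_nhds hyb] with z hz
      simp only [FiberBundle.extend]
      rw [Trivialization.apply_mk_symm _ hz]
    exact f.contMDiffAt.smul_section hE
  · have : (fun z ↦ f z • FiberBundle.extend E v z) =ᶠ[𝓝 y] 0 := by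
      filter_upwards [(isClosed_tsupport f).isOpen_compl.mem_nhds hy] with z hz
      simp only [image_eq_zero_of_notMem_tsupport hz, zero_smul]
      rfl
    refine ContMDiffAt.congr_of_eventuallyEq
      (contMDiff_zeroSection ℝ (TangentSpace I : M → Type _)).contMDiffAt ?_
    filter_upwards [this] with z hz
    rw [hz]; rfl

variable [RiemannianBundle (fun x : M ↦ TangentSpace I x)]
  [IsContMDiffRiemannianBundle I ∞ E (fun x : M ↦ TangentSpace I x)]

lemma contMDiffAt_of_inner {X : Π x : M, TangentSpace I x} {x : M}
    (h : ∀ Z : Π x : M, TangentSpace I x, CMDiffAt ∞ (T% Z) x →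
      CMDiffAt ∞ (fun y ↦ (inner ℝ (X y) (Z y) : ℝ)) x) : CMDiffAt ∞ (T% X) x := by
  classical
  set e := trivializationAt E (TangentSpace I : M → Type _) x with he
  set b := Module.finBasis ℝ E
  have hx : x ∈ e.baseSet := mem_chart_source H x
  have hs (i) : CMDiffAt ∞ (T% (e.localFrame b i)) x :=
    contMDiffAt_localFrame_of_mem (I := I) ∞ e b i hx
  let G : M → Matrix _ _ ℝ := fun y ↦ Matrix.of fun i j ↦
    inner ℝ (e.localFrame b i y) (e.localFrame b j y)
  let f : M → _ → ℝ := fun y i ↦ inner ℝ (X y) (e.localFrame b i y)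
  have hG (i j) : CMDiffAt ∞ (fun y ↦ G y i j) x := 
    ContMDiffAt.inner_bundle (E := fun x : M ↦ TangentSpace I x) (F := E) (hs i) (hs j)
  have hf (i) : CMDiffAt ∞ (fun y ↦ f y i) x := h _ (hs i)
  have hdet : ∀ y ∈ e.baseSet, (G y).det ≠ 0 := by
    intro y hy hd
    obtain ⟨c, hc, hGc⟩ := Matrix.exists_mulVec_eq_zero_iff.2 hd
    have hv : ∑ i, c i • e.localFrame b i y = 0 := by
      rw [← inner_self_eq_zero (𝕜 := ℝ), sum_inner]
      refine Finset.sum_eq_zero fun i _ ↦ ?_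
      have := congrFun hGc i
      rw [inner_smul_left, inner_sum]
      simp only [Matrix.mulVec, dotProduct, Pi.zero_apply] at this
      rw [← mul_zero (c i), ← this]
      simp [inner_smul_right, G, mul_comm]
    have hli := (e.isLocalFrameOn_localFrame_baseSet I 1 b).linearIndependent hy
    exact hc (funext fun i ↦ Fintype.linearIndependent_iff.1 hli c hv i)
  rw [contMDiffAt_iff_localFrameCoeff b hx]
  intro i
  have key : LinearMap.piApply (e.localFrameCoeff I b i) X =ᶠ[𝓝 x]
      fun y ↦ ((G y).det)⁻¹ * ((G y).updateCol i (f y)).det := by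
    filter_upwards [e.open_baseSet.mem_nhds hx] with y hy
    rw [eq_inv_mul_iff_mul_eq₀ (hdet y hy), ← Matrix.cramer_apply]
    have hfy : f y = (G y).mulVec fun j ↦ e.localFrameCoeff I b j y (X y) := by
      ext j
      simp only [f, G, Matrix.mulVec, dotProduct, Matrix.of_apply]
      conv_lhs => rw [e.eq_sum_localFrameCoeff_smul (I := I) (b := b) (s := X) hy]
      rw [sum_inner]
      exact Finset.sum_congr rfl fun k _ ↦ by
        rw [inner_smul_left, real_inner_comm, mul_comm]; rfl
    rw [hfy, Matrix.cramer_eq_adjugate_mulVec, Matrix.mulVec_mulVec, Matrix.adjugate_mul]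
    simp [Matrix.smul_mulVec]
  refine ContMDiffAt.congr_of_eventuallyEq ?_ key
  refine ContMDiffAt.mul ((contMDiffAt_det hG).inv₀ (hdet x hx)) (contMDiffAt_det fun k l ↦ ?_)
  by_cases hl : l = i
  · subst hl; simpa using hf k
  · simpa [Matrix.updateCol_ne hl] using hG k l

end SmoothFields

section PullbackConnection

variable {E : Type*} [NormedAddCommGroup E] [NormedSpace ℝ E] [FiniteDimensional ℝ E]
  {H : Type*} [TopologicalSpace H] {I : ModelWithCorners ℝ E H} [I.Boundaryless]
  {M : Type*} [TopologicalSpace M] [ChartedSpace H M] [IsManifold I ∞ M]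
  {E' : Type*} [NormedAddCommGroup E'] [NormedSpace ℝ E'] [FiniteDimensional ℝ E']
  {H' : Type*} [TopologicalSpace H'] {I' : ModelWithCorners ℝ E' H'} [I'.Boundaryless]
  {B : Type*} [TopologicalSpace B] [ChartedSpace H' B] [IsManifold I' ∞ B]

open Filter Topology VectorField

lemma mvfderiv_finset_sum {ι : Type} (u : Finset ι) {f : ι → M → ℝ} {x : M}
    (h : ∀ i ∈ u, MDiffAt (f i) x) :
    d% (fun y ↦ ∑ i ∈ u, f i y) x = ∑ i ∈ u, d% (f i) x := by
  classical
  induction u using Finset.induction_on with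
  | empty => simpa using mvfderiv_const (I := I) (M := M) (0 : ℝ)
  | insert i u hi ih =>
    simp only [Finset.sum_insert hi]
    have h' : ∀ j ∈ u, MDiffAt (f j) x := fun j hj ↦ h j (Finset.mem_insert_of_mem hj)
    rw [← ih h']
    have h2 : MDiffAt (fun y ↦ ∑ j ∈ u, f j y) x := by
      have : MDiffAt (∑ j ∈ u, f j) x := MDifferentiableAt.sum h'
      convert this using 1
      ext y; simp
    exact mvfderiv_add (h i (Finset.mem_insert_self i u)) h2

variable (I') in
/-- The coefficients of a section `s` along `φ` in the local frame near `φ x`. -/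
def alongCoeff (φ : M → B) (x : M) (s : Π x : M, TangentSpace I' (φ x))
    (i : Fin (Module.finrank ℝ E')) : M → ℝ :=
  fun y ↦ (trivializationAt E' (TangentSpace I' : B → Type _) (φ x)).localFrameCoeff I'
    (Module.finBasis ℝ E') i (φ y) (s y)

variable (I') in
/-- The local frame used in the definition of the pullback connection. -/
def alongFrame (p : B) (i : Fin (Module.finrank ℝ E')) : Π q : B, TangentSpace I' q :=
  (trivializationAt E' (TangentSpace I' : B → Type _) p).localFrame (Module.finBasis ℝ E') i

lemma mdifferentiableAt_alongFrame (p : B) (i : Fin (Module.finrank ℝ E')) :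
    MDiffAt (T% (alongFrame I' p i)) p :=
  (contMDiffAt_localFrame_of_mem (I := I') 1 _ _ i
    (mem_chart_source H' p)).mdifferentiableAt (by simp)

lemma alongCoeff_push_eventuallyEq {φ : M → B} {x : M} (hφ : CMDiffAt 2 φ x)
    (X : Π x : M, TangentSpace I x) (i : Fin (Module.finrank ℝ E')) :
    alongCoeff I' φ x (fun y ↦ mfderiv% φ y (X y)) i =ᶠ[𝓝 x]
      fun y ↦ d% (chartCoord I' (Module.finBasis ℝ E') (φ x) i ∘ φ) y (X y) := by
  have h1 : ∀ᶠ y in 𝓝 x, MDiffAt φ y :=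
    ((contMDiffAt_iff_contMDiffAt_nhds (by simp)).1 hφ).mono
      fun y hy ↦ hy.mdifferentiableAt (by simp)
  filter_upwards [h1, hφ.continuousAt.preimage_mem_nhds
    ((chartAt H' (φ x)).open_source.mem_nhds (mem_chart_source H' (φ x)))] with y hy hys
  have hys : φ y ∈ (chartAt H' (φ x)).source := hys
  rw [mvfderiv_comp_apply y ((contMDiffAt_chartCoord (n := 1) _ _ i hys).mdifferentiableAt
    (by simp)) hy, mvfderiv_chartCoord _ _ _ hys]
  rfl

lemma contMDiffAt_chartCoord_comp {φ : M → B} {x : M} (hφ : CMDiffAt 2 φ x)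
    (i : Fin (Module.finrank ℝ E')) :
    CMDiffAt 2 (chartCoord I' (Module.finBasis ℝ E') (φ x) i ∘ φ) x :=
  (contMDiffAt_chartCoord (n := 2) _ _ i (mem_chart_source H' (φ x))).comp x hφ

lemma mdifferentiableAt_alongCoeff_push {φ : M → B} {x : M} (hφ : CMDiffAt 2 φ x)
    {X : Π x : M, TangentSpace I x} (hX : MDiffAt (T% X) x) (i : Fin (Module.finrank ℝ E')) :
    MDiffAt (alongCoeff I' φ x (fun y ↦ mfderiv% φ y (X y)) i) x :=
  (mdifferentiableAt_mvfderiv_apply (contMDiffAt_chartCoord_comp hφ i) hX).congr_of_eventuallyEq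
    (alongCoeff_push_eventuallyEq hφ X i)

lemma eq_sum_alongCoeff (φ : M → B) (s : Π x : M, TangentSpace I' (φ x)) {x y : M}
    (hy : φ y ∈ (chartAt H' (φ x)).source) :
    s y = ∑ i, alongCoeff I' φ x s i y • alongFrame I' (φ x) i (φ y) := by
  have h := (trivializationAt E' (TangentSpace I' : B → Type _) (φ x)).eq_sum_localFrameCoeff_smul
    (I := I') (b := Module.finBasis ℝ E') (s := FiberBundle.extend E' (s y)) (x' := φ y) hy
  simp only [FiberBundle.extend_apply_self] at h
  exact h

variable [RiemannianBundle (fun x : B ↦ TangentSpace I' x)]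
  [IsContMDiffRiemannianBundle I' ∞ E' (fun x : B ↦ TangentSpace I' x)]

lemma pullbackCov_eq (φ : M → B) (s : Π x : M, TangentSpace I' (φ x)) (x : M)
    (v : TangentSpace I x) :
    pullbackCov I I' φ s x v = ∑ i, (d% (alongCoeff I' φ x s i) x v • alongFrame I' (φ x) i (φ x)
      + alongCoeff I' φ x s i x • leviCivita I' B (alongFrame I' (φ x) i) (φ x)
        (mfderiv% φ x v)) := rfl

lemma pullbackCov_zero (φ : M → B) (x : M) (v : TangentSpace I x) :
    pullbackCov I I' φ (fun _ ↦ 0) x v = 0 := by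
  rw [pullbackCov_eq]
  have h (i) : alongCoeff I' φ x (fun _ ↦ 0) i = fun _ : M ↦ 0 := by
    ext y; simp [alongCoeff]
  simp only [h]
  simp [mvfderiv_const]

lemma pullbackCov_add (φ : M → B) {s t : Π x : M, TangentSpace I' (φ x)} {x : M}
    (hs : ∀ i, MDiffAt (alongCoeff I' φ x s i) x) (ht : ∀ i, MDiffAt (alongCoeff I' φ x t i) x)
    (v : TangentSpace I x) :
    pullbackCov I I' φ (fun y ↦ s y + t y) x v
      = pullbackCov I I' φ s x v + pullbackCov I I' φ t x v := by
  simp only [pullbackCov_eq]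
  rw [← Finset.sum_add_distrib]
  refine Finset.sum_congr rfl fun i _ ↦ ?_
  have h : alongCoeff I' φ x (fun y ↦ s y + t y) i
      = alongCoeff I' φ x s i + alongCoeff I' φ x t i := by
    ext y; simp only [alongCoeff, map_add, Pi.add_apply]
  rw [h, mvfderiv_add (hs i) (ht i)]
  simp only [add_apply, Pi.add_apply, add_smul]
  abel

/-- The pullback connection is compatible with the metric. -/
lemma mvfderiv_inner_along {φ : M → B} {s t : Π x : M, TangentSpace I' (φ x)} {x : M}
    (hφ : MDiffAt φ x)
    (hs : ∀ i, MDiffAt (alongCoeff I' φ x s i) x) (ht : ∀ i, MDiffAt (alongCoeff I' φ x t i) x)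
    (v : TangentSpace I x) :
    d% (fun y ↦ (inner ℝ (s y) (t y) : ℝ)) x v
      = inner ℝ (pullbackCov I I' φ s x v) (t x) + inner ℝ (s x) (pullbackCov I I' φ t x v) := by
  set G := fun i j ↦ metricFun (alongFrame I' (φ x) i) (alongFrame I' (φ x) j) with hG
  have hGd (i j) : MDiffAt (G i j) (φ x) :=
    mdiff_metricFun (mdifferentiableAt_alongFrame _ i) (mdifferentiableAt_alongFrame _ j)
  have hGφ (i j) : MDiffAt (G i j ∘ φ) x := (hGd i j).comp x hφ
  have hG' (i j) : d% (G i j ∘ φ) x v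
      = inner ℝ (leviCivita I' B (alongFrame I' (φ x) i) (φ x) (mfderiv% φ x v))
          (alongFrame I' (φ x) j (φ x))
        + inner ℝ (alongFrame I' (φ x) i (φ x))
          (leviCivita I' B (alongFrame I' (φ x) j) (φ x) (mfderiv% φ x v)) := by
    rw [mvfderiv_comp_apply x (hGd i j) hφ]
    have := mvfderiv_metricFun
      (FiberBundle.mdifferentiableAt_extend I' E' (mfderiv% φ x v))
      (mdifferentiableAt_alongFrame (I' := I') (φ x) i)
      (mdifferentiableAt_alongFrame (I' := I') (φ x) j)
    simpa only [FiberBundle.extend_apply_self] using this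
  have hst : (fun y ↦ (inner ℝ (s y) (t y) : ℝ)) =ᶠ[𝓝 x] fun y ↦ ∑ j, ∑ i,
      (alongCoeff I' φ x s i * alongCoeff I' φ x t j * (G i j ∘ φ)) y := by
    filter_upwards [hφ.continuousAt.preimage_mem_nhds
      ((chartAt H' (φ x)).open_source.mem_nhds (mem_chart_source H' (φ x)))] with y hy
    rw [eq_sum_alongCoeff φ s hy, eq_sum_alongCoeff φ t hy]
    simp only [sum_inner, inner_sum, inner_smul_left, inner_smul_right, RCLike.conj_to_real]
    refine Finset.sum_congr rfl fun j _ ↦ ?_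
    rw [Finset.mul_sum]
    refine Finset.sum_congr rfl fun i _ ↦ ?_
    simp only [Pi.mul_apply, Function.comp_apply, hG, metricFun]
    ring
  have hd (i j) : MDiffAt (alongCoeff I' φ x s i * alongCoeff I' φ x t j) x := (hs i).mul (ht j)
  have hdd (i j) : MDiffAt (alongCoeff I' φ x s i * alongCoeff I' φ x t j * (G i j ∘ φ)) x :=
    (hd i j).mul (hGφ i j)
  have hsum : d% (fun y ↦ (inner ℝ (s y) (t y) : ℝ)) x = ∑ j, ∑ i,
      d% (alongCoeff I' φ x s i * alongCoeff I' φ x t j * (G i j ∘ φ)) x := by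
    rw [mvfderiv_congr hst, mvfderiv_finset_sum]
    · exact Finset.sum_congr rfl fun j _ ↦ mvfderiv_finset_sum _ fun i _ ↦ hdd i j
    · intro j _
      have : MDiffAt (∑ i, alongCoeff I' φ x s i * alongCoeff I' φ x t j * (G i j ∘ φ)) x :=
        MDifferentiableAt.sum fun i _ ↦ hdd i j
      convert this using 1
      ext y; simp
  rw [hsum]
  have hxs := mem_chart_source H' (φ x)
  conv_rhs => rw [eq_sum_alongCoeff φ s hxs, eq_sum_alongCoeff φ t hxs, pullbackCov_eq,
    pullbackCov_eq]
  simp only [sum_inner, inner_sum, inner_smul_left, inner_smul_right, RCLike.conj_to_real,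
    inner_add_left, inner_add_right]
  simp only [Finset.mul_sum, ← Finset.sum_add_distrib, sum_apply]
  refine Finset.sum_congr rfl fun j _ ↦ Finset.sum_congr rfl fun i _ ↦ ?_
  rw [mvfderiv_mul (hd i j) (hGφ i j), mvfderiv_mul (hs i) (ht j)]
  simp only [add_apply, smul_apply, smul_eq_mul, Pi.mul_apply, Function.comp_apply]
  rw [hG' i j]
  simp only [hG, metricFun]
  ring

/-- The pullback connection is torsion free. -/
lemma pullbackCov_sub_pullbackCov {φ : M → B} {x : M} (hφ : CMDiffAt 2 φ x)
    {X Y : Π x : M, TangentSpace I x} (hX : MDiffAt (T% X) x) (hY : MDiffAt (T% Y) x) :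
    pullbackCov I I' φ (fun y ↦ mfderiv% φ y (Y y)) x (X x)
        - pullbackCov I I' φ (fun y ↦ mfderiv% φ y (X y)) x (Y x)
      = mfderiv% φ x (mlieBracket I X Y x) := by
  have hxs := mem_chart_source H' (φ x)
  set e := alongFrame I' (φ x) with he
  set D := fun i ↦ leviCivita I' B (e i) (φ x) with hD
  set c := fun (X : Π x : M, TangentSpace I x) i ↦
    alongCoeff I' φ x (fun y ↦ mfderiv% φ y (X y)) i x with hc
  have hsum (X : Π x : M, TangentSpace I x) : mfderiv% φ x (X x) = ∑ i, c X i • e i (φ x) :=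
    eq_sum_alongCoeff φ (fun y ↦ mfderiv% φ y (X y)) hxs
  have hDsymm (i j) : D i (e j (φ x)) = D j (e i (φ x)) := by
    have h := (CovariantDerivative.torsion_eq_zero_iff (leviCivita I' B)).1 torsion_leviCivita
      (mdifferentiableAt_alongFrame (φ x) i) (mdifferentiableAt_alongFrame (φ x) j)
    rw [show mlieBracket I' (alongFrame I' (φ x) i) (alongFrame I' (φ x) j) (φ x) = 0 from
      mlieBracket_localFrame _ _ i j] at h
    exact (sub_eq_zero.1 h).symm
  have hcd (i) : d% (alongCoeff I' φ x (fun y ↦ mfderiv% φ y (Y y)) i) x (X x)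
      - d% (alongCoeff I' φ x (fun y ↦ mfderiv% φ y (X y)) i) x (Y x)
      = c (mlieBracket I X Y) i := by
    rw [mvfderiv_congr (alongCoeff_push_eventuallyEq hφ X i),
      mvfderiv_congr (alongCoeff_push_eventuallyEq hφ Y i),
      ← mvfderiv_mlieBracket (contMDiffAt_chartCoord_comp hφ i) hX hY]
    exact ((alongCoeff_push_eventuallyEq hφ (mlieBracket I X Y) i).self_of_nhds).symm
  have hcomm : ∑ i, c Y i • D i (mfderiv% φ x (X x)) = ∑ i, c X i • D i (mfderiv% φ x (Y x)) := by
    simp only [hsum X, hsum Y, map_sum, map_smul, Finset.smul_sum]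
    rw [Finset.sum_comm]
    refine Finset.sum_congr rfl fun i _ ↦ Finset.sum_congr rfl fun j _ ↦ ?_
    rw [hDsymm, smul_comm]
  rw [hsum, pullbackCov_eq, pullbackCov_eq, Finset.sum_add_distrib, Finset.sum_add_distrib]
  simp only [← hcd, sub_smul, Finset.sum_sub_distrib]
  change _ + ∑ i, c Y i • D i (mfderiv% φ x (X x)) - (_ + ∑ i, c X i • D i (mfderiv% φ x (Y x))) = _
  rw [hcomm]
  abel

end PullbackConnection

section RiemannianSubmersion

variable {E : Type*} [NormedAddCommGroup E] [NormedSpace ℝ E] [FiniteDimensional ℝ E]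
  {H : Type*} [TopologicalSpace H] {I : ModelWithCorners ℝ E H} [I.Boundaryless]
  {M : Type*} [TopologicalSpace M] [ChartedSpace H M] [IsManifold I ∞ M]
  [RiemannianBundle (fun x : M ↦ TangentSpace I x)]
  [IsContMDiffRiemannianBundle I ∞ E (fun x : M ↦ TangentSpace I x)]
  {E' : Type*} [NormedAddCommGroup E'] [NormedSpace ℝ E'] [FiniteDimensional ℝ E']
  {H' : Type*} [TopologicalSpace H'] {I' : ModelWithCorners ℝ E' H'} [I'.Boundaryless]
  {B : Type*} [TopologicalSpace B] [ChartedSpace H' B] [IsManifold I' ∞ B]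
  [RiemannianBundle (fun x : B ↦ TangentSpace I' x)]
  [IsContMDiffRiemannianBundle I' ∞ E' (fun x : B ↦ TangentSpace I' x)]
  {pr : M → B}

open Filter Topology VectorField

lemma mem_vertical_iff {x : M} {v : TangentSpace I x} :
    v ∈ vertical I I' pr x ↔ mfderiv% pr x v = 0 := Iff.rfl

lemma inner_of_mem_vertical_of_mem_horizontal {x : M} {v w : TangentSpace I x}
    (hv : v ∈ vertical I I' pr x) (hw : w ∈ horizontal I I' pr x) : inner ℝ v w = 0 :=
  hw v hv

lemma vert_add_hor (X : Π x : M, TangentSpace I x) (x : M) :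
    vert I I' pr X x + hor I I' pr X x = X x :=
  Submodule.starProjection_add_starProjection_orthogonal _

lemma vert_mem (X : Π x : M, TangentSpace I x) (x : M) :
    vert I I' pr X x ∈ vertical I I' pr x :=
  Submodule.starProjection_apply_mem _ _

lemma hor_mem (X : Π x : M, TangentSpace I x) (x : M) :
    hor I I' pr X x ∈ horizontal I I' pr x :=
  Submodule.starProjection_apply_mem _ _

lemma mfderiv_hor (X : Π x : M, TangentSpace I x) (x : M) :
    mfderiv% pr x (hor I I' pr X x) = mfderiv% pr x (X x) := by
  rw [← vert_add_hor (I' := I') (pr := pr) X x, map_add, mem_vertical_iff.1 (vert_mem X x), zero_add]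

/-- For a horizontal vector `w`, `g(v, w) = g_B(π_* v, π_* w)`. -/
lemma IsRiemannianSubmersion.inner_mfderiv (h : IsRiemannianSubmersion I I' pr) {x : M}
    (v : TangentSpace I x) {w : TangentSpace I x} (hw : w ∈ horizontal I I' pr x) :
    inner ℝ (mfderiv% pr x v) (mfderiv% pr x w) = (inner ℝ v w : ℝ) := by
  set u := (horizontal I I' pr x).starProjection v with hu
  have huv : mfderiv% pr x u = mfderiv% pr x v := by
    have := mfderiv_hor (I := I) (I' := I') (pr := pr) (FiberBundle.extend E v) x
    simpa [hor] using this
  have hum : u ∈ horizontal I I' pr x := Submodule.starProjection_apply_mem _ _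
  have huw : (inner ℝ v w : ℝ) = inner ℝ u w := by
    rw [hu, Submodule.inner_starProjection_left_eq_right,
      Submodule.starProjection_eq_self_iff.2 hw]
  rw [huw, ← huv, real_inner_eq_norm_add_mul_self_sub_norm_mul_self_sub_norm_mul_self_div_two,
    real_inner_eq_norm_add_mul_self_sub_norm_mul_self_sub_norm_mul_self_div_two, ← map_add,
    h.norm_map x _ hum, h.norm_map x _ hw, h.norm_map x _ (add_mem hum hw)]

lemma contMDiffAt_push (h : ContMDiff I I' ∞ pr) {X : Π x : M, TangentSpace I x} {x : M}
    (hX : CMDiffAt ∞ (T% X) x) :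
    ContMDiffAt I I'.tangent ∞
      (fun y ↦ (⟨pr y, mfderiv% pr y (X y)⟩ : TangentBundle I' B)) x :=
  (h.contMDiff_tangentMap (m := ∞) (by simp)).contMDiffAt.comp x hX

lemma IsRiemannianSubmersion.contMDiffAt_hor (h : IsRiemannianSubmersion I I' pr)
    {X : Π x : M, TangentSpace I x} {x : M} (hX : CMDiffAt ∞ (T% X) x) :
    CMDiffAt ∞ (T% (hor I I' pr X)) x := by
  refine contMDiffAt_of_inner fun Z hZ ↦ ?_
  have e : (fun y ↦ (inner ℝ (hor I I' pr X y) (Z y) : ℝ))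
      = fun y ↦ inner ℝ (mfderiv% pr y (X y)) (mfderiv% pr y (Z y)) := by
    ext y
    rw [real_inner_comm, ← h.inner_mfderiv _ (hor_mem X y), mfderiv_hor, real_inner_comm]
  rw [e]
  exact ContMDiffAt.inner_bundle (E := fun x : B ↦ TangentSpace I' x) (F := E')
    (contMDiffAt_push h.smooth hX) (contMDiffAt_push h.smooth hZ)

lemma IsRiemannianSubmersion.isHorizontalField_hor (h : IsRiemannianSubmersion I I' pr)
    {X : Π x : M, TangentSpace I x} (hX : IsSmoothField X) :
    IsHorizontalField I I' pr (hor I I' pr X) :=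
  ⟨fun x ↦ h.contMDiffAt_hor (hX x), hor_mem X⟩

lemma IsRiemannianSubmersion.isVerticalField_vert (h : IsRiemannianSubmersion I I' pr)
    {X : Π x : M, TangentSpace I x} (hX : IsSmoothField X) :
    IsVerticalField I I' pr (vert I I' pr X) := by
  refine ⟨?_, vert_mem X⟩
  have e : vert I I' pr X = X - hor I I' pr X := by
    ext x; rw [Pi.sub_apply, ← vert_add_hor (I' := I') (pr := pr) X x, add_sub_cancel_right]
  rw [e]
  exact fun x ↦ (hX x).sub_section (h.contMDiffAt_hor (hX x))

lemma IsSmoothField.mdifferentiableAt {X : Π x : M, TangentSpace I x} (hX : IsSmoothField X)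
    (x : M) : MDiffAt (T% X) x :=
  (hX x).mdifferentiableAt (by simp)

section SecondFundamentalForm

variable {X Y Z : Π x : M, TangentSpace I x} {x : M}

lemma nabla_sub_nabla (hX : MDiffAt (T% X) x) (hY : MDiffAt (T% Y) x) :
    nabla I X Y x - nabla I Y X x = mlieBracket I X Y x :=
  (CovariantDerivative.torsion_eq_zero_iff (leviCivita I M)).1 torsion_leviCivita hX hY

lemma nabla_add (hX : MDiffAt (T% X) x) (hY : MDiffAt (T% Y) x) :
    nabla I Z (X + Y) x = nabla I Z X x + nabla I Z Y x := by
  have := (leviCivita I M).isCovariantDerivativeOnUniv.add hX hY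
  simp only [nabla]
  rw [this]; rfl

lemma secondFundamentalForm_symm (h : CMDiffAt 2 pr x) (hX : MDiffAt (T% X) x)
    (hY : MDiffAt (T% Y) x) :
    secondFundamentalForm I I' pr X Y x = secondFundamentalForm I I' pr Y X x := by
  rw [← sub_eq_zero]
  simp only [secondFundamentalForm]
  have h1 := pullbackCov_sub_pullbackCov (I' := I') h hX hY
  rw [← nabla_sub_nabla hX hY, map_sub] at h1
  rw [sub_sub_sub_comm, h1, sub_self]

lemma secondFundamentalForm_add_left (X X' Y : Π x : M, TangentSpace I x) (x : M) :
    secondFundamentalForm I I' pr (X + X') Y x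
      = secondFundamentalForm I I' pr X Y x + secondFundamentalForm I I' pr X' Y x := by
  have h1 (s : Π x : M, TangentSpace I' (pr x)) (v w : TangentSpace I x) :
      pullbackCov I I' pr s x (v + w) = pullbackCov I I' pr s x v + pullbackCov I I' pr s x w := by
    simp only [pullbackCov_eq, map_add, add_smul, smul_add, ← Finset.sum_add_distrib]
    exact Finset.sum_congr rfl fun i _ ↦ by abel
  simp only [secondFundamentalForm, nabla, Pi.add_apply, map_add, h1]
  abel

lemma secondFundamentalForm_add_right (h : CMDiffAt 2 pr x) (X : Π x : M, TangentSpace I x)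
    (hY : MDiffAt (T% Y) x) (hZ : MDiffAt (T% Z) x) :
    secondFundamentalForm I I' pr X (Y + Z) x
      = secondFundamentalForm I I' pr X Y x + secondFundamentalForm I I' pr X Z x := by
  simp only [secondFundamentalForm, Pi.add_apply, map_add, nabla_add hY hZ]
  rw [pullbackCov_add pr (fun i ↦ mdifferentiableAt_alongCoeff_push h hY i)
    (fun i ↦ mdifferentiableAt_alongCoeff_push h hZ i)]
  abel

lemma secondFundamentalForm_of_vertical (X : Π x : M, TangentSpace I x)
    (hY : ∀ y, Y y ∈ vertical I I' pr y) (x : M) :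
    secondFundamentalForm I I' pr X Y x = -mfderiv% pr x (nabla I X Y x) := by
  have : (fun y ↦ mfderiv% pr y (Y y)) = fun _ ↦ 0 := funext fun y ↦ mem_vertical_iff.1 (hY y)
  rw [secondFundamentalForm, this, pullbackCov_zero, zero_sub]

/-- On horizontal fields, `g_B((∇π_*)(X, Y), π_* Z)` is skew in `Y` and `Z`. -/
lemma IsRiemannianSubmersion.inner_secondFundamentalForm_skew (h : IsRiemannianSubmersion I I' pr)
    (hX : MDiffAt (T% X) x) (hY : MDiffAt (T% Y) x) (hZ : MDiffAt (T% Z) x)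
    (hYh : ∀ y, Y y ∈ horizontal I I' pr y) (hZh : ∀ y, Z y ∈ horizontal I I' pr y) :
    (inner ℝ (secondFundamentalForm I I' pr X Y x) (mfderiv% pr x (Z x)) : ℝ)
      + inner ℝ (secondFundamentalForm I I' pr X Z x) (mfderiv% pr x (Y x)) = 0 := by
  have hpr : CMDiffAt 2 pr x := (h.smooth x).of_le ENat.LEInfty.out
  have h1 := mvfderiv_inner_along (I' := I') (hpr.mdifferentiableAt (by simp))
    (fun i ↦ mdifferentiableAt_alongCoeff_push hpr hY i)
    (fun i ↦ mdifferentiableAt_alongCoeff_push hpr hZ i) (X x)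
  have e : (fun y ↦ (inner ℝ (mfderiv% pr y (Y y)) (mfderiv% pr y (Z y)) : ℝ)) = metricFun Y Z :=
    funext fun y ↦ h.inner_mfderiv _ (hZh y)
  rw [e, mvfderiv_metricFun hX hY hZ] at h1
  simp only [secondFundamentalForm, inner_sub_left]
  rw [h.inner_mfderiv _ (hZh x), h.inner_mfderiv _ (hYh x)]
  rw [real_inner_comm _ (mfderiv% pr x (Y x))] at h1
  rw [real_inner_comm _ (Y x)] at h1
  simp only [nabla]
  linarith

/-- The second fundamental form of a Riemannian submersion vanishes on horizontal fields. -/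
lemma IsRiemannianSubmersion.secondFundamentalForm_horizontal (h : IsRiemannianSubmersion I I' pr)
    (hX : MDiffAt (T% X) x) (hY : MDiffAt (T% Y) x)
    (hXh : ∀ y, X y ∈ horizontal I I' pr y) (hYh : ∀ y, Y y ∈ horizontal I I' pr y) :
    secondFundamentalForm I I' pr X Y x = 0 := by
  have hpr : CMDiffAt 2 pr x := (h.smooth x).of_le ENat.LEInfty.out
  refine ext_inner_right ℝ fun w ↦ ?_
  obtain ⟨z, rfl⟩ := h.maximal_rank x w
  set Z := hor I I' pr (FiberBundle.extend E z) with hZdef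
  have hZ : MDiffAt (T% Z) x :=
    (h.contMDiffAt_hor (FiberBundle.contMDiffAt_extend I E z)).mdifferentiableAt (by simp)
  have hZh : ∀ y, Z y ∈ horizontal I I' pr y := hor_mem _
  have hz : mfderiv% pr x z = mfderiv% pr x (Z x) := by
    rw [hZdef, mfderiv_hor, FiberBundle.extend_apply_self]
  rw [hz, inner_zero_left]
  have k1 := h.inner_secondFundamentalForm_skew hX hY hZ hYh hZh
  have k2 := h.inner_secondFundamentalForm_skew hY hZ hX hZh hXh
  have k3 := h.inner_secondFundamentalForm_skew hZ hX hY hXh hYh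
  rw [secondFundamentalForm_symm hpr hX hZ] at k1
  rw [secondFundamentalForm_symm hpr hY hX] at k2
  rw [secondFundamentalForm_symm hpr hZ hY] at k3
  linarith

end SecondFundamentalForm

end RiemannianSubmersion

section LocallyConformalKaehler

variable {E : Type*} [NormedAddCommGroup E] [NormedSpace ℝ E] [FiniteDimensional ℝ E]
  {H : Type*} [TopologicalSpace H] {I : ModelWithCorners ℝ E H} [I.Boundaryless]
  {M : Type*} [TopologicalSpace M] [ChartedSpace H M] [IsManifold I ∞ M]
  [RiemannianBundle (fun x : M ↦ TangentSpace I x)]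
  [IsContMDiffRiemannianBundle I ∞ E (fun x : M ↦ TangentSpace I x)]
  {J : Π x : M, TangentSpace I x →L[ℝ] TangentSpace I x}
  {ω₀ : Π x : M, TangentSpace I x →L[ℝ] ℝ}
  {X Y Z : Π x : M, TangentSpace I x}

lemma IsHermitian.isSmoothField_appField (h : IsHermitian J) (hX : IsSmoothField X) :
    IsSmoothField (appField J X) :=
  ContMDiff.clm_bundle_apply (E₁ := (TangentSpace I : M → Type _))
    (E₂ := (TangentSpace I : M → Type _)) h.smooth hX

lemma IsHermitian.inner_left (h : IsHermitian J) {x : M} (v w : TangentSpace I x) :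
    inner ℝ (J x v) w = -(inner ℝ v (J x w) : ℝ) := by
  rw [← h.orthogonal x v, h.sq, inner_neg_right, neg_neg]

lemma IsHermitian.appField_appField (h : IsHermitian J) (X : Π x : M, TangentSpace I x) :
    appField J (appField J X) = -X :=
  funext fun x ↦ h.sq x (X x)

lemma leviCivita_neg (x : M) (hX : MDiffAt (T% X) x) :
    leviCivita I M (-X) x = -leviCivita I M X x := by
  have := (leviCivita I M).isCovariantDerivativeOnUniv.smul_const (σ := X) (-1) hX
  simpa using this

/-- `g((∇_X J) Y, Z)`. -/
def nablaJ (J : Π x : M, TangentSpace I x →L[ℝ] TangentSpace I x)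
    (X Y Z : Π x : M, TangentSpace I x) (x : M) : ℝ :=
  inner ℝ (nabla I X (appField J Y) x - J x (nabla I X Y x)) (Z x)

lemma IsHermitian.nablaJ_eq (h : IsHermitian J) (X Y Z : Π x : M, TangentSpace I x) (x : M) :
    nablaJ J X Y Z x = inner ℝ (nabla I X (appField J Y) x) (Z x)
      + inner ℝ (nabla I X Y x) (J x (Z x)) := by
  rw [nablaJ, inner_sub_left, h.inner_left, sub_neg_eq_add]

lemma IsHermitian.nablaJ_skew (h : IsHermitian J) (hX : IsSmoothField X) (hY : IsSmoothField Y)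
    (hZ : IsSmoothField Z) (x : M) : nablaJ J X Y Z x = -nablaJ J X Z Y x := by
  have hJY := h.isSmoothField_appField hY
  have hJZ := h.isSmoothField_appField hZ
  have h1 := mvfderiv_metricFun (hX.mdifferentiableAt x) (hJY.mdifferentiableAt x)
    (hZ.mdifferentiableAt x)
  have h2 := mvfderiv_metricFun (hX.mdifferentiableAt x) (hY.mdifferentiableAt x)
    (hJZ.mdifferentiableAt x)
  have e : metricFun (appField J Y) Z = -metricFun Y (appField J Z) :=
    funext fun y ↦ h.inner_left (Y y) (Z y)
  rw [e, mvfderiv_neg, neg_apply, h2] at h1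
  rw [h.nablaJ_eq, h.nablaJ_eq]
  rw [real_inner_comm (leviCivita I M Z x (X x)), real_inner_comm _ (Y x)] at h1
  simp only [nabla]
  simp only [appField] at h1 ⊢
  linarith

lemma IsHermitian.nablaJ_appField (h : IsHermitian J) (X : Π x : M, TangentSpace I x)
    (hY : IsSmoothField Y) (Z : Π x : M, TangentSpace I x) (x : M) :
    nablaJ J X (appField J Y) Z x = nablaJ J X Y (appField J Z) x := by
  rw [h.nablaJ_eq, h.nablaJ_eq, h.appField_appField]
  simp only [nabla, leviCivita_neg x (hY.mdifferentiableAt x), appField, h.sq, inner_neg_right,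
    neg_apply, inner_neg_left]
  ring

lemma IsHermitian.nablaJ_nijenhuis (h : IsHermitian J) (hX : IsSmoothField X)
    (hY : IsSmoothField Y) (Z : Π x : M, TangentSpace I x) (x : M) :
    nablaJ J (appField J X) Y Z x - nablaJ J (appField J Y) X Z x - nablaJ J Y X (appField J Z) x
      + nablaJ J X Y (appField J Z) x = 0 := by
  have hJX := (h.isSmoothField_appField hX).mdifferentiableAt x
  have hJY := (h.isSmoothField_appField hY).mdifferentiableAt x
  have hX' := hX.mdifferentiableAt x
  have hY' := hY.mdifferentiableAt x
  have hN := congrArg (fun v ↦ (inner ℝ v (Z x) : ℝ)) (h.nijenhuis X Y hX hY x)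
  simp only [← nabla_sub_nabla hJX hJY, ← nabla_sub_nabla hJX hY', ← nabla_sub_nabla hX' hJY,
    ← nabla_sub_nabla hX' hY', inner_sub_left, map_sub, h.inner_left, inner_zero_left] at hN
  simp only [h.nablaJ_eq]
  simp only [appField, h.sq, inner_neg_right] at hN ⊢
  linarith

lemma IsHermitian.extDeriv₂_kaehlerForm (h : IsHermitian J) (hX : IsSmoothField X)
    (hY : IsSmoothField Y) (hZ : IsSmoothField Z) (x : M) :
    extDeriv₂ (kaehlerForm J) X Y Z x
      = nablaJ J X Z Y x + nablaJ J Y X Z x + nablaJ J Z Y X x := by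
  have hJX := (h.isSmoothField_appField hX).mdifferentiableAt x
  have hJY := (h.isSmoothField_appField hY).mdifferentiableAt x
  have hJZ := (h.isSmoothField_appField hZ).mdifferentiableAt x
  have hX' := hX.mdifferentiableAt x
  have hY' := hY.mdifferentiableAt x
  have hZ' := hZ.mdifferentiableAt x
  have h1 := mvfderiv_metricFun hX' hY' hJZ
  have h2 := mvfderiv_metricFun hY' hZ' hJX
  have h3 := mvfderiv_metricFun hZ' hX' hJY
  have e (Y Z : Π x : M, TangentSpace I x) :
      (fun y ↦ kaehlerForm J y (Y y) (Z y)) = metricFun Y (appField J Z) := rfl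
  simp only [extDeriv₂, e, h1, h2, h3, h.nablaJ_eq]
  simp only [← nabla_sub_nabla hX' hY', ← nabla_sub_nabla hY' hZ', ← nabla_sub_nabla hZ' hX',
    kaehlerForm, inner_sub_left]
  simp only [nabla, appField]
  rw [real_inner_comm _ (X x), real_inner_comm _ (Y x), real_inner_comm _ (Z x)]
  ring

/-- The covariant derivative of the complex structure of a locally conformal Kähler manifold. -/
lemma IsLCK.nablaJ_formula (h : IsLCK J ω₀) (hX : IsSmoothField X) (hY : IsSmoothField Y)
    (hZ : IsSmoothField Z) (x : M) :
    nablaJ J X Y Z x = 1 / 2 * (ω₀ x (J x (Y x)) * inner ℝ (X x) (Z x)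
      - ω₀ x (Y x) * inner ℝ (J x (X x)) (Z x) - inner ℝ (X x) (J x (Y x)) * ω₀ x (Z x)
      - inner ℝ (X x) (Y x) * ω₀ x (J x (Z x))) := by
  have hh := h.hermitian
  have hJX := hh.isSmoothField_appField hX
  have hJY := hh.isSmoothField_appField hY
  have hJZ := hh.isSmoothField_appField hZ
  have d1 := h.lee.extDeriv_kaehlerForm X Y Z hX hY hZ x
  have d2 := h.lee.extDeriv_kaehlerForm X _ _ hX hJY hJZ x
  rw [hh.extDeriv₂_kaehlerForm hX hY hZ] at d1
  rw [hh.extDeriv₂_kaehlerForm hX hJY hJZ] at d2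
  have n := hh.nablaJ_nijenhuis hY hZ (appField J X) x
  have hneg (X Y Z : Π x : M, TangentSpace I x) : nablaJ J X Y (-Z) x = -nablaJ J X Y Z x := by
    simp [nablaJ]
  rw [hh.appField_appField, hneg, hneg] at n
  rw [hh.nablaJ_appField X hZ, hh.appField_appField, hneg, hh.nablaJ_skew hJY hX hJZ,
    hh.nablaJ_appField _ hZ, hh.nablaJ_appField _ hY] at d2
  rw [hh.nablaJ_skew hY hX hZ] at d1
  rw [hh.nablaJ_skew hX hY hZ]
  simp only [wedge₁₂, kaehlerForm, appField, hh.sq, inner_neg_right, hh.orthogonal] at d1 d2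
  rw [hh.inner_left (X x), real_inner_comm (Z x) (X x)]
  rw [hh.inner_left (Y x)] at d2
  rw [real_inner_comm (J x (X x)) (Z x), hh.inner_left (X x)] at d1
  linarith

end LocallyConformalKaehler

section LagrangianSubmersion

variable {E : Type*} [NormedAddCommGroup E] [NormedSpace ℝ E] [FiniteDimensional ℝ E]
  {H : Type*} [TopologicalSpace H] {I : ModelWithCorners ℝ E H} [I.Boundaryless]
  {M : Type*} [TopologicalSpace M] [ChartedSpace H M] [IsManifold I ∞ M]
  [RiemannianBundle (fun x : M ↦ TangentSpace I x)]
  [IsContMDiffRiemannianBundle I ∞ E (fun x : M ↦ TangentSpace I x)]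
  {E' : Type*} [NormedAddCommGroup E'] [NormedSpace ℝ E'] [FiniteDimensional ℝ E']
  {H' : Type*} [TopologicalSpace H'] {I' : ModelWithCorners ℝ E' H'} [I'.Boundaryless]
  {B : Type*} [TopologicalSpace B] [ChartedSpace H' B] [IsManifold I' ∞ B]
  [RiemannianBundle (fun x : B ↦ TangentSpace I' x)]
  [IsContMDiffRiemannianBundle I' ∞ E' (fun x : B ↦ TangentSpace I' x)]
  {pr : M → B}
  {J : Π x : M, TangentSpace I x →L[ℝ] TangentSpace I x}
  {ω₀ : Π x : M, TangentSpace I x →L[ℝ] ℝ}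
  {V W X Y : Π x : M, TangentSpace I x}

lemma IsLeeForm.isSmoothField_leeField (h : IsLeeForm J ω₀) : IsSmoothField (leeField ω₀) := by
  intro x
  refine contMDiffAt_of_inner fun Z hZ ↦ ?_
  have e : (fun y ↦ (inner ℝ (leeField ω₀ y) (Z y) : ℝ)) = fun y ↦ ω₀ y (Z y) :=
    funext fun y ↦ by rw [real_inner_comm, inner_leeField]
  rw [e]
  have : ContMDiffAt I (I.prod 𝓘(ℝ)) ∞
      (fun m ↦ TotalSpace.mk' ℝ (E := Bundle.Trivial M ℝ) m (ω₀ m (Z m))) x :=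
    ContMDiffAt.clm_bundle_apply (E₁ := (TangentSpace I : M → Type _))
      (E₂ := Bundle.Trivial M ℝ) h.smooth.contMDiffAt hZ
  simp only [contMDiffAt_totalSpace] at this
  exact this.2

/-- The covariant derivative of `J Y` on a locally conformal Kähler manifold. -/
lemma IsLCK.nabla_appField [T2Space M] (h : IsLCK J ω₀) (hX : IsSmoothField X)
    (hY : IsSmoothField Y) (x : M) :
    nabla I X (appField J Y) x = J x (nabla I X Y x)
      + (1 / 2 : ℝ) • (ω₀ x (J x (Y x)) • X x - ω₀ x (Y x) • J x (X x)
        - kaehlerForm J x (X x) (Y x) • leeField ω₀ x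
        - (inner ℝ (X x) (Y x) : ℝ) • antiLeeField J ω₀ x) := by
  rw [← sub_eq_iff_eq_add']
  refine ext_inner_right ℝ fun z ↦ ?_
  obtain ⟨Z, hZ, rfl⟩ := exists_isSmoothField x z
  refine (h.nablaJ_formula hX hY hZ x).trans ?_
  simp only [inner_smul_left, inner_sub_left, RCLike.conj_to_real, antiLeeField, inner_neg_left,
    h.hermitian.inner_left (leeField ω₀ x), neg_neg, kaehlerForm]
  rw [real_inner_comm (Z x) (leeField ω₀ x), inner_leeField,
    real_inner_comm (J x (Z x)) (leeField ω₀ x), inner_leeField]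

lemma vert_of_vertical (hX : ∀ x, X x ∈ vertical I I' pr x) : vert I I' pr X = X :=
  funext fun x ↦ Submodule.starProjection_eq_self_iff.2 (hX x)

lemma hor_of_horizontal (hX : ∀ x, X x ∈ horizontal I I' pr x) : hor I I' pr X = X :=
  funext fun x ↦ Submodule.starProjection_eq_self_iff.2 (hX x)

lemma vert_of_horizontal (hX : ∀ x, X x ∈ horizontal I I' pr x) : vert I I' pr X = 0 := by
  funext x
  have h := vert_add_hor (I' := I') (pr := pr) X x
  rw [hor_of_horizontal hX] at h
  simpa using h

lemma starProjection_vertical_of_mem_horizontal {x : M} {v : TangentSpace I x}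
    (hv : v ∈ horizontal I I' pr x) : (vertical I I' pr x).starProjection v = 0 :=
  (Submodule.starProjection_apply_eq_zero_iff _).2 hv

lemma hor_eq_zero_iff {x : M} : hor I I' pr X x = 0 ↔ mfderiv% pr x (X x) = 0 := by
  refine ⟨fun h ↦ by rw [← mfderiv_hor, h, map_zero], fun h ↦ ?_⟩
  refine inner_self_eq_zero (𝕜 := ℝ).1 ?_
  exact inner_of_mem_vertical_of_mem_horizontal
    (mem_vertical_iff.2 ((mfderiv_hor (I' := I') X x).trans h)) (hor_mem X x)

lemma nabla_zero_right (X : Π x : M, TangentSpace I x) : nabla I X 0 = 0 := by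
  funext x
  simp [nabla]

lemma tensorT_of_vertical_of_horizontal (hV : ∀ x, V x ∈ vertical I I' pr x)
    (hX : ∀ x, X x ∈ horizontal I I' pr x) :
    tensorT I I' pr V X = vert I I' pr (nabla I V X) := by
  rw [tensorT, vert_of_vertical hV, vert_of_horizontal hX, hor_of_horizontal hX, nabla_zero_right]
  funext x
  simp [hor]

lemma tensorA_of_horizontal (hX : ∀ x, X x ∈ horizontal I I' pr x)
    (hY : ∀ x, Y x ∈ horizontal I I' pr x) :
    tensorA I I' pr X Y = vert I I' pr (nabla I X Y) := by
  rw [tensorA, vert_of_horizontal hY, hor_of_horizontal hX, hor_of_horizontal hY, nabla_zero_right]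
  funext x
  simp [hor]

namespace IsLagrangianSubmersion

lemma map_mem_horizontal (h : IsLagrangianSubmersion I I' J pr) {x : M} {v : TangentSpace I x}
    (hv : v ∈ vertical I I' pr x) : J x v ∈ horizontal I I' pr x := by
  rw [← h.lagrangian x]
  exact ⟨v, hv, rfl⟩

lemma map_mem_vertical (h : IsLagrangianSubmersion I I' J pr) (hJ : IsHermitian J) {x : M}
    {v : TangentSpace I x} (hv : v ∈ horizontal I I' pr x) : J x v ∈ vertical I I' pr x := by
  rw [← h.lagrangian x] at hv
  obtain ⟨u, hu, rfl⟩ := hv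
  change J x (J x u) ∈ _
  rw [hJ.sq]
  exact neg_mem hu

/-- The vertical part of `∇_X J W` for a vertical field `W`, when the Lee field is vertical. -/
lemma vert_nabla_appField [T2Space M] (h : IsLagrangianSubmersion I I' J pr) (hM : IsLCK J ω₀)
    (hB : ∀ x, leeField ω₀ x ∈ vertical I I' pr x) (hX : IsSmoothField X)
    (hW : IsVerticalField I I' pr W) (x : M) :
    vert I I' pr (nabla I X (appField J W)) x = J x (hor I I' pr (nabla I X W) x)
      - (1 / 2 * ω₀ x (W x) : ℝ) • (vertical I I' pr x).starProjection (J x (X x))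
      - (1 / 2 * kaehlerForm J x (X x) (W x) : ℝ) • leeField ω₀ x := by
  have hJ := hM.hermitian
  have hω : ω₀ x (J x (W x)) = 0 := by
    rw [← inner_leeField, real_inner_comm]
    exact inner_of_mem_vertical_of_mem_horizontal (hB x) (h.map_mem_horizontal (hW.2 x))
  have hA : (vertical I I' pr x).starProjection (antiLeeField J ω₀ x) = 0 :=
    starProjection_vertical_of_mem_horizontal (neg_mem (h.map_mem_horizontal (hB x)))
  have hBp : (vertical I I' pr x).starProjection (leeField ω₀ x) = leeField ω₀ x :=
    Submodule.starProjection_eq_self_iff.2 (hB x)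
  have hJn : (vertical I I' pr x).starProjection (J x (nabla I X W x))
      = J x (hor I I' pr (nabla I X W) x) := by
    conv_lhs => rw [← vert_add_hor (I' := I') (pr := pr) (nabla I X W) x, map_add, map_add]
    rw [starProjection_vertical_of_mem_horizontal (h.map_mem_horizontal (vert_mem _ x)), zero_add]
    exact Submodule.starProjection_eq_self_iff.2 (h.map_mem_vertical hJ (hor_mem _ x))
  rw [vert, hM.nabla_appField hX hW.1 x, hω]
  simp only [map_add, map_sub, map_smul, hA, hBp, hJn, zero_smul, smul_zero, sub_zero, zero_sub, map_neg]
  module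

lemma tensorT_appField [T2Space M] (h : IsLagrangianSubmersion I I' J pr) (hM : IsLCK J ω₀)
    (hB : ∀ x, leeField ω₀ x ∈ vertical I I' pr x) (hV : IsVerticalField I I' pr V)
    (hW : IsVerticalField I I' pr W) (x : M) :
    tensorT I I' pr V (appField J W) x = J x (hor I I' pr (nabla I V W) x) := by
  have hΩ : kaehlerForm J x (V x) (W x) = 0 :=
    inner_of_mem_vertical_of_mem_horizontal (hV.2 x) (h.map_mem_horizontal (hW.2 x))
  rw [tensorT_of_vertical_of_horizontal (X := appField J W) hV.2 fun x ↦ h.map_mem_horizontal (hW.2 x),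
    h.vert_nabla_appField hM hB hV.1 hW, hΩ,
    starProjection_vertical_of_mem_horizontal (h.map_mem_horizontal (hV.2 x))]
  simp

lemma tensorA_appField_add [T2Space M] (h : IsLagrangianSubmersion I I' J pr) (hM : IsLCK J ω₀)
    (hB : ∀ x, leeField ω₀ x ∈ vertical I I' pr x) (hX : IsHorizontalField I I' pr X)
    (hW : IsVerticalField I I' pr W) (x : M) :
    tensorA I I' pr X (appField J W) x + (1 / 2 * ω₀ x (W x) : ℝ) • J x (X x)
      + (1 / 2 * kaehlerForm J x (X x) (W x) : ℝ) • leeField ω₀ x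
      = J x (hor I I' pr (nabla I X W) x) := by
  rw [tensorA_of_horizontal (Y := appField J W) hX.2 fun x ↦ h.map_mem_horizontal (hW.2 x),
    h.vert_nabla_appField hM hB hX.1 hW,
    Submodule.starProjection_eq_self_iff.2 (h.map_mem_vertical hM.hermitian (hX.2 x))]
  module

end IsLagrangianSubmersion

lemma IsHermitian.map_eq_zero_iff (h : IsHermitian J) {x : M} {v : TangentSpace I x} :
    J x v = 0 ↔ v = 0 := by
  refine ⟨fun hv ↦ ?_, fun hv ↦ by rw [hv, map_zero]⟩
  rw [← neg_eq_zero, ← h.sq x v, hv, map_zero]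

/-- If `π` is totally geodesic, `∇_X Y` is horizontal for horizontal `X`, `Y`. -/
lemma inner_nabla_of_isTotallyGeodesicMap (hg : IsTotallyGeodesicMap I I' pr)
    (hX : IsSmoothField X) (hY : IsHorizontalField I I' pr Y) (hW : IsVerticalField I I' pr W)
    (x : M) : (inner ℝ (nabla I X Y x) (W x) : ℝ) = 0 := by
  have h1 := mvfderiv_metricFun (hX.mdifferentiableAt x) (hY.1.mdifferentiableAt x)
    (hW.1.mdifferentiableAt x)
  have e : metricFun Y W = fun _ ↦ 0 := funext fun y ↦ by
    rw [metricFun, real_inner_comm]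
    exact inner_of_mem_vertical_of_mem_horizontal (hW.2 y) (hY.2 y)
  have h2 := hg X W hX hW.1 x
  rw [secondFundamentalForm_of_vertical X hW.2, neg_eq_zero] at h2
  have h3 : (inner ℝ (Y x) (leviCivita I M W x (X x)) : ℝ) = 0 := by
    rw [real_inner_comm]
    exact inner_of_mem_vertical_of_mem_horizontal (mem_vertical_iff.2 h2) (hY.2 x)
  rw [e, mvfderiv_const, h3, add_zero] at h1
  exact h1.symm

end LagrangianSubmersion
end LCK
end

open LCK in
theorem theorem4p6
    {E : Type*} [NormedAddCommGroup E] [NormedSpace ℝ E] [FiniteDimensional ℝ E]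
    {H : Type*} [TopologicalSpace H] (I : ModelWithCorners ℝ E H) [I.Boundaryless]
    {M : Type*} [TopologicalSpace M] [T2Space M] [ChartedSpace H M] [IsManifold I ∞ M]
    [RiemannianBundle (fun x : M ↦ TangentSpace I x)]
    [IsContMDiffRiemannianBundle I ∞ E (fun x : M ↦ TangentSpace I x)]
    {E' : Type*} [NormedAddCommGroup E'] [NormedSpace ℝ E'] [FiniteDimensional ℝ E']
    {H' : Type*} [TopologicalSpace H'] (I' : ModelWithCorners ℝ E' H') [I'.Boundaryless]
    {B : Type*} [TopologicalSpace B] [T2Space B] [ChartedSpace H' B] [IsManifold I' ∞ B]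
    [RiemannianBundle (fun x : B ↦ TangentSpace I' x)]
    [IsContMDiffRiemannianBundle I' ∞ E' (fun x : B ↦ TangentSpace I' x)]
    (J : Π x : M, TangentSpace I x →L[ℝ] TangentSpace I x)
    (ω₀ : Π x : M, TangentSpace I x →L[ℝ] ℝ)
    (hM : LCK.IsLCK J ω₀)
    (pr : M → B) (hpr : LCK.IsLagrangianSubmersion I I' J pr)
    (hB₁ : ∀ x, LCK.leeField ω₀ x ∈ LCK.vertical I I' pr x) :
    LCK.IsTotallyGeodesicMap I I' pr ↔
      (∀ V W : Π x : M, TangentSpace I x,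
        LCK.IsVerticalField I I' pr V → LCK.IsVerticalField I I' pr W → ∀ x,
          LCK.tensorT I I' pr V (LCK.appField J W) x + (1 / 2 * ω₀ x (W x) : ℝ) • J x (V x)
            + (1 / 2 * inner ℝ (V x) (W x) : ℝ) • LCK.antiLeeField J ω₀ x = 0) ∧
      (∀ X W : Π x : M, TangentSpace I x,
        LCK.IsHorizontalField I I' pr X → LCK.IsVerticalField I I' pr W → ∀ x,
          LCK.tensorA I I' pr X (LCK.appField J W) x + (1 / 2 * ω₀ x (W x) : ℝ) • J x (X x)
            + (1 / 2 * LCK.kaehlerForm J x (X x) (W x) : ℝ) • LCK.leeField ω₀ x = 0) := by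
  have hJ := hM.hermitian
  constructor
  · intro hg
    have hhor (X W) (hX : IsSmoothField X) (hW : IsVerticalField I I' pr W) (x : M) :
        hor I I' pr (nabla I X W) x = 0 := by
      have h := hg X W hX hW.1 x
      rwa [secondFundamentalForm_of_vertical X hW.2, neg_eq_zero, ← hor_eq_zero_iff] at h
    have hA (X W) (hX : IsHorizontalField I I' pr X) (hW : IsVerticalField I I' pr W) (x : M) :=
      hpr.tensorA_appField_add hM hB₁ hX hW x
    refine ⟨fun V W hV hW x ↦ ?_, fun X W hX hW x ↦ ?_⟩
    · have hJV : IsHorizontalField I I' pr (appField J V) :=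
        ⟨hJ.isSmoothField_appField hV.1, fun y ↦ hpr.map_mem_horizontal (hV.2 y)⟩
      have hJW : IsHorizontalField I I' pr (appField J W) :=
        ⟨hJ.isSmoothField_appField hW.1, fun y ↦ hpr.map_mem_horizontal (hW.2 y)⟩
      have hLee : IsVerticalField I I' pr (leeField ω₀) := ⟨hM.lee.isSmoothField_leeField, hB₁⟩
      set u : TangentSpace I x := (1 / 2 * ω₀ x (W x) : ℝ) • V x
        - (1 / 2 * inner ℝ (V x) (W x) : ℝ) • leeField ω₀ x with hu
      have hAu : vert I I' pr (nabla I (appField J V) (appField J W)) x = u := by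
        have h1 := hA _ W hJV hW x
        rw [hhor _ W hJV.1 hW, map_zero, tensorA_of_horizontal hJV.2 hJW.2] at h1
        simp only [appField, kaehlerForm, hJ.sq, hJ.orthogonal] at h1
        rw [smul_neg, add_assoc, ← sub_eq_neg_add] at h1
        rw [eq_neg_of_add_eq_zero_left h1, neg_sub]
      have horth (U) (hU : IsVerticalField I I' pr U) : (inner ℝ u (U x) : ℝ) = 0 := by
        have h1 := inner_nabla_of_isTotallyGeodesicMap hg hJV.1 hJW hU x
        rw [← vert_add_hor (I' := I') (pr := pr) (nabla I _ _) x, inner_add_left, hAu,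
          real_inner_comm (U x) (hor I I' pr _ x),
          inner_of_mem_vertical_of_mem_horizontal (hU.2 x) (hor_mem _ x), add_zero] at h1
        exact h1
      have hu0 : u = 0 := by
        rw [← inner_self_eq_zero (𝕜 := ℝ)]
        nth_rewrite 2 [hu]
        rw [inner_sub_right, inner_smul_right, inner_smul_right, horth V hV, horth _ hLee]
        simp
      rw [hpr.tensorT_appField hM hB₁ hV hW, hhor V W hV.1 hW, map_zero, zero_add, antiLeeField,
        smul_neg, ← sub_eq_add_neg, ← map_smul, ← map_smul, ← map_sub, ← hu, hu0, map_zero]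
    · rw [hA X W hX hW, hhor X W hX.1 hW, map_zero]
  · rintro ⟨hT, hA⟩ X Y hX hY x
    have hr := hpr.riemannian
    have hd : CMDiffAt 2 pr x := (hr.smooth x).of_le ENat.LEInfty.out
    have hvert (X W) (hX : IsSmoothField X) (hW : IsVerticalField I I' pr W) :
        secondFundamentalForm I I' pr X W x = 0 := by
      have hVX := hr.isVerticalField_vert hX
      have hHX := hr.isHorizontalField_hor hX
      have h1 : hor I I' pr (nabla I (vert I I' pr X) W) x = 0 := by
        have h := hT _ W hVX hW x
        rw [hpr.tensorT_appField hM hB₁ hVX hW] at h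
        have h' := congrArg (vertical I I' pr x).starProjection h
        rw [map_add, map_add, map_smul, map_smul, map_zero,
          starProjection_vertical_of_mem_horizontal (hpr.map_mem_horizontal (hVX.2 x)),
          starProjection_vertical_of_mem_horizontal (v := antiLeeField J ω₀ x)
            (neg_mem (hpr.map_mem_horizontal (hB₁ x))), smul_zero, smul_zero, add_zero, add_zero,
          Submodule.starProjection_eq_self_iff.2 (hpr.map_mem_vertical hJ (hor_mem _ x))] at h'
        exact hJ.map_eq_zero_iff.1 h'
      have h2 : hor I I' pr (nabla I (hor I I' pr X) W) x = 0 := by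
        have h := hA _ W hHX hW x
        rwa [hpr.tensorA_appField_add hM hB₁ hHX hW, hJ.map_eq_zero_iff] at h
      rw [secondFundamentalForm_of_vertical X hW.2, neg_eq_zero]
      rw [hor_eq_zero_iff] at h1 h2
      have : nabla I X W x = nabla I (vert I I' pr X) W x + nabla I (hor I I' pr X) W x := by
        simp only [nabla, ← map_add, vert_add_hor]
      rw [this, map_add, h1, h2, add_zero]
    have hsplit (Y : Π x : M, TangentSpace I x) : Y = vert I I' pr Y + hor I I' pr Y :=
      funext fun y ↦ (vert_add_hor Y y).symm
    have hVX := hr.isVerticalField_vert hX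
    have hHX := hr.isHorizontalField_hor hX
    have hVY := hr.isVerticalField_vert hY
    have hHY := hr.isHorizontalField_hor hY
    rw [hsplit Y, secondFundamentalForm_add_right hd X (hVY.1.mdifferentiableAt x)
      (hHY.1.mdifferentiableAt x), hvert X _ hX hVY, zero_add, hsplit X,
      secondFundamentalForm_add_left, secondFundamentalForm_symm hd (hVX.1.mdifferentiableAt x)
      (hHY.1.mdifferentiableAt x), hvert _ _ hHY.1 hVX, zero_add]
    exact hr.secondFundamentalForm_horizontal (hHX.1.mdifferentiableAt x)
      (hHY.1.mdifferentiableAt x) hHX.2 hHY.2
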